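/- Let $n,N$ be positive integers, write $\langle n\rangle=\{1,\dots,n\}$, and let $\Theta$ be a set partition of $\langle n\rangle$ with $k=|\Theta|$ blocks. **Combinatorial notation.** A *bond* is a two-element subset of $\langle n\rangle$. Partitions are ordered by refinement, with greatest element $\mathbf 1_n=\{\langle n\rangle\}$. For a set $\Gamma$ of bonds, $\Gamma\vee\Theta$ is the finest partition of $\langle n\rangle$ that is coarser than or equal to $\Theta$ and has each member of $\Gamma$ contained in one of its blocks. $\mathrm{Tree}_n(\Theta)$ is the set of all sets $\Gamma$ of bonds with $\Gamma\vee\Theta=\mathbf 1_n$ and $|\Gamma|+1=|\Theta|$. For a partition $\Pi$, $[\Pi]$ is the $n\times n$ matrix with $[\Pi](i,j)=1$ if $i,j$ lie in the same block of $\Pi$ and $0$ otherwise. $\mathfrak Q_n$ is the set of real symmetric positive semidefinite $n\times n$ matrices with all entries in $[0,1]$ and all diagonal entries equal to $1$. **The measures.** For $\Gamma\in\mathrm{Tree}_n(\Theta)$, $\mathbb P^\Theta_\Gamma$ is the measure determined by $$\int F\,d\mathbb P^\Theta_\Gamma=\sum_{(e_1,\dots,e_{k-1}):\,\{e_1,\dots,e_{k-1}\}=\Gamma}\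 \int_{1>t_1>\cdots>t_{k-1}>0}F\Big([\Theta]+\sum_{\alpha=1}^{k-1}t_\alpha\big([\{e_1,\dots,e_\alpha\}\vee\Theta]-[\{e_1,\dots,e_{\alpha-1}\}\vee\Theta]\big)\Big)\,dt_1\cdots dt_{k-1}$$ for continuous functions $F$ on $\mathfrak Q_n$. **Polynomials and operators.** Let $z=\{z_{ij}\}_{1\le i\le n,\,0\le j\le 2N}$ be commuting variables. For a bond $e=\{i,i'\}$ put $D_e=\sum_{j=0}^{2N}\frac{\partial^2}{\partial z_{ij}\partial z_{i'j}}$, and put $D^\Gamma=\prod_{e\in\Gamma}D_e$. For each block $A\in\Theta$ let $f_A\in\mathbb R[\{z_{ij}\}_{i\in A,\,0\le j\le 2N}]$, and let $f=\prod_{A\in\Theta}f_A$. **Gaussian families.** Let $\zeta=\{\zeta_{ij}\}_{1\le i\le n,\,0\le j\le 2N}$ be real random variables with a centred (possibly degenerate) Gaussian joint distribution such that $\mathbf E\,\zeta_{ij}\zeta_{i'j'}=\delta_{jj'}\,\mathbf E\,\zeta_{i0}\zeta_{i'0}$. For $Q\in\mathfrak Q_n$, $\zeta\star Q$ denotes any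 family of real random variables with a centred Gaussian joint distribution and covariances $\mathbf E(\zeta\star Q)_{ij}(\zeta\star Q)_{i'j'}=Q(i,i')\,\mathbf E\,\zeta_{ij}\zeta_{i'j'}$; its probability space may depend on $Q$. **Joint cumulant.** For a finite family $\{X_s\}_{s\in S}$ of random variables with absolute moments of all orders, $\kappa(\{X_s\}_{s\in S})=\big(\prod_{s\in S}\frac{\partial}{\partial t_s}\big)\log\mathbf E\exp\big(\sum_{s\in S}t_sX_s\big)\big|_{t=0}$, where the variables $t_s$ are treated formally. **Theorem.** The variables $f_A(\zeta)$ have absolute moments of all orders. For each $Q\in\mathfrak Q_n$ a family $\zeta\star Q$ exists and its law is uniquely determined. Each $\mathbb P^\Theta_\Gamma$, $\Gamma\in\mathrm{Tree}_n(\Theta)$, is a probability measure on $\mathfrak Q_n$. For every $g\in\mathbb R[z]$ and $\Gamma\in\mathrm{Tree}_n(\Theta)$, the random variable $g(\zeta\star Q)$ is integrable for every $Q\in\mathfrak Q_n$, and $Q\mapsto\mathbf E[g(\zeta\star Q)]$ is $\mathbb P^\Theta_\Gamma$-integrable. Finally, $$\kappa\big(\{f_A(\zeta)\}_{A\in\Theta}\big)=\sum_{\Gamma\in\mathrm{Tree}_n(\Theta)}\Big(\prod_{\{i,i'\}\in\Gamma}\mathbf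 E\,\zeta_{i0}\zeta_{i'0}\Big)\int\mathbf E\big[(D^\Gamma f)(\zeta\star Q)\big]\,\mathbb P^\Theta_\Gamma(dQ).$$ -/

import Mathlib

open MeasureTheory ProbabilityTheory

noncomputable section

namespace BKAR

/-! ### Joint cumulants -/

/-- The formal moment generating series `E exp (∑ i, t i * X i)`, a formal power series in the
variables `t i`: the coefficient of `t ^ ν` is `E (∏ i, X i ^ ν i) / ∏ i, (ν i)!`. -/
def formalMGF {Ω S : Type*} [MeasurableSpace Ω] [Fintype S] (P : Measure Ω) (X : S → Ω → ℝ) :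
    MvPowerSeries S ℝ :=
  fun ν => (∫ ω, ∏ i, X i ω ^ ν i ∂P) / ∏ i, ((ν i).factorial : ℝ)

/-- The joint cumulant `(∏ i, ∂/∂t i) log E exp (∑ i, t i * X i)` at `t = 0`, all variables `t i`
being treated formally. `PowerSeries.log ℝ` is the series of `log (1 + X)`, and the value at `t = 0`
of the derivative, once in each variable, is the coefficient of `∏ i, t i`. -/
def jointCumulant {Ω S : Type*} [MeasurableSpace Ω] [Fintype S] (P : Measure Ω)
    (X : S → Ω → ℝ) : ℝ :=
  MvPowerSeries.coeff (Finsupp.equivFunOnFinite.symm fun _ : S => 1)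
    ((PowerSeries.log ℝ).subst (formalMGF P X - 1))

/-! ### Partitions, bonds and trees -/

/-- Set partitions of an `n`-element set, ordered by refinement. -/
abbrev SetPart (n : ℕ) : Type := Finpartition (Finset.univ : Finset (Fin n))

/-- The bonds: two-element subsets `{i, j}`, `i ≠ j`. -/
def bonds (n : ℕ) : Finset (Sym2 (Fin n)) := Finset.univ.filter fun e => ¬ e.IsDiag

open scoped Classical in
/-- `Γ ∨ Θ`: the greatest lower bound of the partitions that are coarser than `Θ` and have
each member of `Γ` contained in one of their blocks. -/
def join {n : ℕ} (Γ : Finset (Sym2 (Fin n))) (Θ : SetPart n) : SetPart n :=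
  (Finset.univ.filter fun Ψ : SetPart n =>
    Θ ≤ Ψ ∧ ∀ e ∈ Γ, ∃ B ∈ Ψ.parts, ∀ i ∈ e, i ∈ B).inf id

open scoped Classical in
/-- The sets of bonds `Γ` with `Γ ∨ Θ = 1` and `|Γ| + 1 = |Θ|`. -/
def trees {n : ℕ} (Θ : SetPart n) : Finset (Finset (Sym2 (Fin n))) :=
  (bonds n).powerset.filter fun Γ => join Γ Θ = ⊤ ∧ Γ.card + 1 = Θ.parts.card

open scoped Classical in
/-- The zero-one matrix `[Ψ]` representing a partition. -/
def partMatrix {n : ℕ} (Ψ : SetPart n) : Matrix (Fin n) (Fin n) ℝ :=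
  Matrix.of fun i j => if ∃ A ∈ Ψ.parts, i ∈ A ∧ j ∈ A then 1 else 0

/-- The symmetric positive semidefinite matrices with entries in `[0, 1]` and unit diagonal. -/
def couplings (n : ℕ) : Set (Matrix (Fin n) (Fin n) ℝ) :=
  {Q | Q.PosSemidef ∧ (∀ i j, Q i j ∈ Set.Icc (0 : ℝ) 1) ∧ ∀ i, Q i i = 1}

/-! ### The tree measures -/

instance matrixMeasurableSpace {n : ℕ} : MeasurableSpace (Matrix (Fin n) (Fin n) ℝ) :=
  inferInstanceAs (MeasurableSpace (Fin n → Fin n → ℝ))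

instance matrixBorelSpace {n : ℕ} : BorelSpace (Matrix (Fin n) (Fin n) ℝ) :=
  inferInstanceAs (BorelSpace (Fin n → Fin n → ℝ))

/-- The open simplex `1 > t 0 > ⋯ > t (m - 1) > 0`. -/
def simplex (m : ℕ) : Set (Fin m → ℝ) :=
  {t | StrictAnti t ∧ ∀ α, t α ∈ Set.Ioo (0 : ℝ) 1}

/-- The matrix
`[Θ] + ∑ α, t α • ([{e 0, …, e α} ∨ Θ] - [{e 0, …, e (α - 1)} ∨ Θ])`. -/
def pathMatrix {n m : ℕ} (Θ : SetPart n) (e : Fin m → Sym2 (Fin n)) (t : Fin m → ℝ) :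
    Matrix (Fin n) (Fin n) ℝ :=
  partMatrix Θ + ∑ α, t α • (partMatrix (join ((Finset.Iic α).image e) Θ) -
    partMatrix (join ((Finset.Iio α).image e) Θ))

/-- The measure attached to `Θ` and a tree `Γ`: the sum, over all enumerations
`e 0, …, e (k - 2)` of `Γ`, with `k` the number of blocks of `Θ`, of the images of Lebesgue measure
on the simplex under `pathMatrix Θ e`. -/
def treeMeasure {n : ℕ} (Θ : SetPart n) (Γ : Finset (Sym2 (Fin n))) :
    Measure (Matrix (Fin n) (Fin n) ℝ) :=
  ∑ e ∈ Finset.univ.filter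
      (fun e : Fin (Θ.parts.card - 1) → Sym2 (Fin n) => Finset.univ.image e = Γ),
    ((volume : Measure (Fin (Θ.parts.card - 1) → ℝ)).restrict (simplex _)).map (pathMatrix Θ e)

/-! ### Differential operators -/

/-- The index set of the variables `z i j` with `i` in an `n`-element set and `0 ≤ j ≤ 2N`. -/
abbrev Var (n N : ℕ) : Type := Fin n × Fin (2 * N + 1)

/-- The partial derivative `∂/∂z p` as a linear operator on polynomials. -/
def partialOp {n N : ℕ} (p : Var n N) : Module.End ℝ (MvPolynomial (Var n N) ℝ) :=
  (MvPolynomial.pderiv p : Derivation ℝ (MvPolynomial (Var n N) ℝ) _).toLinearMap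

theorem partialOp_commute {n N : ℕ} (p q : Var n N) :
    Commute (partialOp p) (partialOp q) := by
  have h : ⁅(MvPolynomial.pderiv p : Derivation ℝ (MvPolynomial (Var n N) ℝ) (MvPolynomial (Var n N) ℝ)),
      (MvPolynomial.pderiv q : Derivation ℝ (MvPolynomial (Var n N) ℝ) (MvPolynomial (Var n N) ℝ))⁆ = 0 := by
    apply MvPolynomial.derivation_ext
    intro i
    rw [Derivation.commutator_apply]
    simp only [MvPolynomial.pderiv_X, Pi.single_apply, Derivation.zero_apply]
    split_ifs <;> simp
  apply LinearMap.ext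
  intro g
  have hg := DFunLike.congr_fun h g
  rw [Derivation.commutator_apply, Derivation.zero_apply, sub_eq_zero] at hg
  exact hg

/-- `D_e = ∑ j, ∂²/∂z i j ∂z i' j` for `e = {i, i'}`. -/
def bondOp {n : ℕ} (N : ℕ) : Sym2 (Fin n) → Module.End ℝ (MvPolynomial (Var n N) ℝ) :=
  Sym2.lift ⟨fun i i' => ∑ j : Fin (2 * N + 1), partialOp (i, j) * partialOp (i', j),
    fun i i' => Finset.sum_congr rfl fun j _ => partialOp_commute (i, j) (i', j)⟩

theorem bondOp_commute {n N : ℕ} (e e' : Sym2 (Fin n)) :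
    Commute (bondOp N e) (bondOp N e') := by
  induction e using Sym2.ind with
  | _ a b =>
    induction e' using Sym2.ind with
    | _ c d =>
      simp only [bondOp, Sym2.lift_mk]
      refine Commute.sum_left _ _ _ fun j _ => Commute.sum_right _ _ _ fun j' _ => ?_
      exact ((partialOp_commute _ _).mul_right (partialOp_commute _ _)).mul_left
        ((partialOp_commute _ _).mul_right (partialOp_commute _ _))

/-- `D^Γ`, the product of the commuting operators `D_e`, `e ∈ Γ`. -/
def treeOp {n : ℕ} (N : ℕ) (Γ : Finset (Sym2 (Fin n))) :
    Module.End ℝ (MvPolynomial (Var n N) ℝ) :=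
  Γ.noncommProd (bondOp N) fun e _ e' _ _ => bondOp_commute e e'

/-! ### Gaussian families -/

/-- The family `X` has a centred (possibly degenerate) Gaussian joint distribution under `P`. -/
structure IsCentredGaussian {Ω S : Type*} [MeasurableSpace Ω] [Fintype S] (P : Measure Ω)
    (X : S → Ω → ℝ) : Prop where
  gaussian : HasGaussianLaw (fun ω s => X s ω) P
  mean_zero : ∀ s, ∫ ω, X s ω ∂P = 0

/-- The family `ζ'` arises from the family `ζ` by `Q`-recoupling: it is centred Gaussian with
`E (ζ' i j * ζ' i' j') = Q i i' * E (ζ i j * ζ i' j')`. -/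
structure IsRecoupling {n N : ℕ} {Ω Ω' : Type*} [MeasurableSpace Ω] [MeasurableSpace Ω']
    (P : Measure Ω) (ζ : Var n N → Ω → ℝ) (Q : Matrix (Fin n) (Fin n) ℝ)
    (P' : Measure Ω') (ζ' : Var n N → Ω' → ℝ) : Prop where
  centred : IsCentredGaussian P' ζ'
  covariance : ∀ p q : Var n N,
    ∫ ω, ζ' p ω * ζ' q ω ∂P' = Q p.1 q.1 * ∫ ω, ζ p ω * ζ q ω ∂P

/-- `E (ζ i 0 * ζ i' 0)` for `e = {i, i'}`. -/
def bondCov {n N : ℕ} {Ω : Type*} [MeasurableSpace Ω] (P : Measure Ω) (ζ : Var n N → Ω → ℝ) :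
    Sym2 (Fin n) → ℝ :=
  Sym2.lift ⟨fun i i' => ∫ ω, ζ (i, 0) ω * ζ (i', 0) ω ∂P,
    fun i i' => by simp only [mul_comm]⟩

/-- The random variable `g(ζ)` for a polynomial `g`. -/
def polyVar {n N : ℕ} {Ω : Type*} (g : MvPolynomial (Var n N) ℝ) (ζ : Var n N → Ω → ℝ)
    (ω : Ω) : ℝ :=
  MvPolynomial.eval (fun p => ζ p ω) g

end BKAR

end

open BKAR

/-! By Wick's theorem, E[g(ζ⋆Q)] is a polynomial in the entries of Q, with one variable per
unordered pair of indices (`recoupledMean`, `integral_recoupling`). Let F be this polynomial for g =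
f. Both sides of the formula are linear functionals of F, and they turn out to agree on every
polynomial F.

Cumulant side: expanding the logarithm gives the sum over p of (-1)^(p-1)/p times the sum, over
surjective colourings of the blocks of Θ by p colours, of a product over the colours of expectations
(`jointCumulant_eq_sum`). If Π is the partition into colour classes, different classes are
uncorrelated, hence independent, in ζ⋆[Π], so this product is F([Π]) (`colourValue_recoupledMean`).
The result is `colourSum`.

Tree side: differentiating a Gaussian expectation in an off-diagonal entry of Q brings down the
covariance of that bond and applies D_e to g (`pderiv_recoupledMean`). So the right side is a sum,
over enumerated trees, of simplex integrals of iterated partial derivatives of F along the path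
matrices; this is `treeSum`.

The two agree by induction on the number of blocks (`treeSum_eq_colourSum`). If Θ has at least two
blocks, the logarithm coefficients weighted by the numbers of colourings add up to zero
(`sum_log_surjCount`), so F([Θ]) may be subtracted from every F([Π]). Along the segment from [Θ] to
[Π] the difference is the sum over b of the increment of the entry b times the integral of the b-th
partial derivative of F. That increment is 1 if b joins two blocks of Θ and lies inside a block of
Π, and 0 otherwise; it is 1 exactly when b joins two blocks of Θ and the colouring is also a
colouring of {b} ∨ Θ. Exchanging the sums leaves `colourSum` for {b} ∨ Θ, applied to a rescaled
derivative of F. Unrolling the induction, nested segments become path matrices, products of segment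
parameters become the coordinates of the simplex, and the bond sequences that merge two blocks at
each step are exactly the enumerations of trees (`joinsUp_iff_mem_trees`). -/

noncomputable section

namespace BKAR

/-! ### The Wick functional of a symmetric matrix -/

section Wick

open MvPolynomial

variable {V R : Type*} [Fintype V] [CommRing R] [Algebra ℝ R]

/-- The quadratic form `½ ∑ c p q * X p * X q`. -/
def quadForm (c : V → V → R) : MvPolynomial V R :=
  (1 / 2 : ℝ) • ∑ p, ∑ q, C (c p q) * (X p * X q)

theorem quadForm_isHomogeneous (c : V → V → R) : (quadForm c).IsHomogeneous 2 := by
  have hS : (∑ p, ∑ q, C (c p q) * (X p * X q) : MvPolynomial V R).IsHomogeneous 2 := by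
    refine IsHomogeneous.sum _ _ _ fun p _ => IsHomogeneous.sum _ _ _ fun q _ => ?_
    exact IsHomogeneous.C_mul ((isHomogeneous_X R p).mul (isHomogeneous_X R q)) _
  intro d hd
  refine hS (d := d) fun h => hd ?_
  rw [quadForm, coeff_smul, h, smul_zero]

theorem pderiv_quadForm {c : V → V → R} (hc : ∀ p q, c p q = c q p) (r : V) :
    pderiv r (quadForm c) = ∑ q, C (c r q) * X q := by
  classical
  have h1 : pderiv r (quadForm c) =
      (1 / 2 : ℝ) • pderiv r (∑ p, ∑ q, C (c p q) * (X p * X q)) :=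
    ((pderiv r : Derivation R (MvPolynomial V R) _).restrictScalars ℝ).map_smul _ _
  have h2 : pderiv r (∑ p, ∑ q, C (c p q) * (X p * X q) : MvPolynomial V R) =
      ∑ q, C (c r q) * X q + ∑ q, C (c r q) * X q := by
    simp only [map_sum, pderiv_mul, pderiv_C, zero_mul, zero_add, pderiv_X, mul_add,
      Finset.sum_add_distrib]
    congr 1
    · rw [Finset.sum_comm]
      refine Finset.sum_congr rfl fun q _ => ?_
      rw [Finset.sum_eq_single r]
      · simp
      · intro b _ hb
        simp [hb]
      · simp
    · refine Finset.sum_congr rfl fun q _ => ?_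
      rw [Finset.sum_eq_single r]
      · simp [hc q r]
      · intro b _ hb
        simp [hb]
      · simp
  rw [h1, h2, ← two_smul ℝ, smul_smul]
  norm_num

/-- The moments of a centred Gaussian family with covariances `c`. -/
def wickMoment (c : V → V → R) (ν : V →₀ ℕ) : R :=
  ((∏ p, ((ν p).factorial : ℝ)) / ((ν.degree / 2).factorial : ℝ)) •
    coeff ν (quadForm c ^ (ν.degree / 2))

/-- The halved degree is rounded down, so the power of the quadratic form is homogeneous of degree
one less than `ν`. -/
theorem wickMoment_of_odd (c : V → V → R) {ν : V →₀ ℕ} (h : ν.degree % 2 = 1) :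
    wickMoment c ν = 0 := by
  rw [wickMoment, ((quadForm_isHomogeneous c).pow _).coeff_eq_zero (by omega), smul_zero]

/-- Moments are the coefficients of the exponential of the quadratic form, multiplied by factorials;
differentiating that exponential in the variable `p` gives this recursion. Here only the homogeneous
piece of the relevant degree is differentiated. -/
theorem wickMoment_add_single {c : V → V → R} (hc : ∀ p q, c p q = c q p) (ν : V →₀ ℕ) (p : V) :
    wickMoment c (ν + Finsupp.single p 1) =
      ∑ q, (ν q : ℝ) • (c p q * wickMoment c (ν - Finsupp.single q 1)) := by
  classical
  have hdeg : (ν + Finsupp.single p 1).degree = ν.degree + 1 := by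
    rw [map_add, Finsupp.degree_single]
  have hsub : ∀ q, ν q ≠ 0 → ν - Finsupp.single q 1 + Finsupp.single q 1 = ν := fun q hq =>
    tsub_add_cancel_of_le (by rw [Finsupp.single_le_iff]; omega)
  have hdeg' : ∀ q, ν q ≠ 0 → (ν - Finsupp.single q 1).degree + 1 = ν.degree := fun q hq => by
    conv_rhs => rw [← hsub q hq, map_add, Finsupp.degree_single]
  have hfac : ∀ (μ : V →₀ ℕ) (q : V), ∏ r, (((μ + Finsupp.single q 1 : V →₀ ℕ) r).factorial : ℝ) =
      (μ q + 1) * ∏ r, ((μ r).factorial : ℝ) := by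
    intro μ q
    rw [← Finset.mul_prod_erase _ _ (Finset.mem_univ q),
      ← Finset.mul_prod_erase (f := fun r => ((μ r).factorial : ℝ)) _ (Finset.mem_univ q),
      ← mul_assoc]
    congr 1
    · simp [Nat.factorial_succ]
    · refine Finset.prod_congr rfl fun r hr => ?_
      simp [(Finset.ne_of_mem_erase hr).symm]
  rcases Nat.even_or_odd' ν.degree with ⟨k, hk | hk⟩
  · rw [wickMoment_of_odd c (by omega)]
    refine (Finset.sum_eq_zero fun q _ => ?_).symm
    by_cases hq : ν q = 0
    · simp [hq]
    · have := hdeg' q hq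
      rw [wickMoment_of_odd c (by omega), mul_zero, smul_zero]
  · have hL : (ν + Finsupp.single p 1).degree / 2 = k + 1 := by omega
    -- The coefficient at `ν` of ∂_p q^(k+1) = (k+1) q^k ∑ c_pq X_q, where q is the quadratic form.
    have hcoef : ((ν p : ℝ) + 1) • coeff (ν + Finsupp.single p 1) (quadForm c ^ (k + 1)) =
        ((k : ℝ) + 1) • ∑ q, c p q * coeff ν (quadForm c ^ k * X q) := by
      have h := coeff_pderiv (i := p) (quadForm c ^ (k + 1)) ν
      rw [pderiv_pow, pderiv_quadForm hc] at h
      have h' : ((ν p : ℝ) + 1) • coeff (ν + Finsupp.single p 1) (quadForm c ^ (k + 1)) =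
          coeff (ν + Finsupp.single p 1) (quadForm c ^ (k + 1)) * ((ν p : R) + 1) := by
        rw [mul_comm, Algebra.smul_def]
        simp
      rw [h', ← h, Algebra.smul_def, Finset.mul_sum, coeff_sum, Finset.mul_sum]
      refine Finset.sum_congr rfl fun q _ => ?_
      have : ((↑(k + 1) : MvPolynomial V R) * quadForm c ^ (k + 1 - 1) * (C (c p q) * X q)) =
          C ((k : R) + 1) * (C (c p q) * (quadForm c ^ k * X q)) := by
        simp only [Nat.add_sub_cancel, map_add, map_natCast, map_one]
        push_cast
        ring
      rw [this, coeff_C_mul, coeff_C_mul]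
      simp
    have hk1 : ((k : ℝ) + 1) ≠ 0 := by positivity
    rw [wickMoment, hL, hfac, Nat.factorial_succ]
    have : (((ν p : ℝ) + 1) * ∏ r, ((ν r).factorial : ℝ)) / (((k + 1) * k.factorial : ℕ) : ℝ) =
        ((∏ r, ((ν r).factorial : ℝ)) / (((k : ℝ) + 1) * k.factorial)) * ((ν p : ℝ) + 1) := by
      push_cast
      ring
    rw [this, mul_smul, hcoef, smul_smul, Finset.smul_sum]
    refine Finset.sum_congr rfl fun q _ => ?_
    by_cases hq : ν q = 0
    · rw [coeff_mul_X', if_neg (by simpa using hq), hq]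
      simp
    · rw [coeff_mul_X', if_pos (by simpa using hq), wickMoment]
      have hd : (ν - Finsupp.single q 1).degree / 2 = k := by
        have := hdeg' q hq
        omega
      have hf := hfac (ν - Finsupp.single q 1) q
      rw [hsub q hq] at hf
      have hν : (((ν - Finsupp.single q 1 : V →₀ ℕ) q : ℝ) + 1) = ν q := by
        have : (ν - Finsupp.single q 1 : V →₀ ℕ) q + 1 = ν q := by
          simp only [Finsupp.tsub_apply, Finsupp.single_eq_same]
          omega
        exact_mod_cast this
      rw [hν] at hf
      rw [hd, hf, mul_smul_comm, smul_smul]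
      congr 1
      field_simp

/-- The expectation functional on polynomials in a centred Gaussian family with covariances `c`,
defined over an arbitrary algebra of coefficients. -/
def wick (c : V → V → R) : MvPolynomial V ℝ →ₗ[ℝ] R :=
  (basisMonomials V ℝ).constr ℝ (wickMoment c)

theorem wick_monomial (c : V → V → R) (ν : V →₀ ℕ) (a : ℝ) :
    wick c (monomial ν a) = a • wickMoment c ν := by
  have h : wick c (monomial ν 1) = wickMoment c ν := by
    have := (basisMonomials V ℝ).constr_basis ℝ (wickMoment c) ν
    rwa [coe_basisMonomials] at this
  rw [← h, ← map_smul, smul_monomial, smul_eq_mul, mul_one]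

@[simp]
theorem wick_one (c : V → V → R) : wick c 1 = 1 := by
  have : (1 : MvPolynomial V ℝ) = monomial 0 1 := rfl
  rw [this, wick_monomial]
  simp [wickMoment]

/-- Gaussian integration by parts, the only property of `wick` used from here on besides linearity
and its value at 1. -/
theorem wick_X_mul {c : V → V → R} (hc : ∀ p q, c p q = c q p) (p : V)
    (g : MvPolynomial V ℝ) :
    wick c (X p * g) = ∑ q, c p q * wick c (pderiv q g) := by
  induction g using MvPolynomial.induction_on' with
  | monomial ν a =>
    rw [X, monomial_mul, one_mul, wick_monomial, add_comm, wickMoment_add_single hc,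
      Finset.smul_sum]
    refine Finset.sum_congr rfl fun q _ => ?_
    rw [pderiv_monomial, wick_monomial, mul_smul_comm, smul_smul]
  | add f g hf hg =>
    rw [mul_add, map_add, hf, hg, ← Finset.sum_add_distrib]
    simp only [map_add, mul_add]

theorem pderiv_eq_zero_of_mem_supported {V : Type*} {A : Set V} {g : MvPolynomial V ℝ}
    (hg : g ∈ supported ℝ A) {q : V} (hq : q ∉ A) : pderiv q g = 0 :=
  pderiv_eq_zero_of_notMem_vars fun h => hq (mem_supported.1 hg h)

/-- A linear functional on the polynomials in the variables from `A` which satisfies the Wick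
recursion and annihilates constants is zero. -/
theorem eq_zero_of_wick_recursion {A : Set V} (c : V → V → R) (T : MvPolynomial V ℝ →ₗ[ℝ] R)
    (h1 : T 1 = 0)
    (hT : ∀ p ∈ A, ∀ g ∈ supported ℝ A, T (X p * g) = ∑ q, c p q * T (pderiv q g))
    {g : MvPolynomial V ℝ} (hg : g ∈ supported ℝ A) : T g = 0 := by
  classical
  -- Induction on the degree: the recursion removes one variable as a factor and one more by
  -- differentiation. Supports only shrink, so the argument stays within `A`.
  have key : ∀ (d : ℕ) (ν : V →₀ ℕ), ν.degree = d → (ν.support : Set V) ⊆ A →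
      T (monomial ν 1) = 0 := by
    intro d
    induction d using Nat.strong_induction_on with
    | _ d ih =>
      intro ν hd hν
      by_cases h0 : ν = 0
      · rw [h0]
        exact h1
      · obtain ⟨p, hp⟩ := Finsupp.support_nonempty_iff.2 h0
        have hle : Finsupp.single p 1 ≤ ν := by
          rw [Finsupp.single_le_iff]
          have := Finsupp.mem_support_iff.1 hp
          omega
        set μ := ν - Finsupp.single p 1 with hμ
        have hνμ : ν = Finsupp.single p 1 + μ := (add_tsub_cancel_of_le hle).symm
        have hμA : (μ.support : Set V) ⊆ A := fun x hx => hν (Finsupp.support_tsub hx)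
        have hX : (monomial ν 1 : MvPolynomial V ℝ) = X p * monomial μ 1 := by
          rw [X, monomial_mul, one_mul, hνμ]
        have hmem : (monomial μ 1 : MvPolynomial V ℝ) ∈ supported ℝ A := by
          rw [mem_supported, vars_monomial one_ne_zero]
          exact hμA
        have hdeg : μ.degree + 1 = d := by
          rw [← hd, hνμ, map_add, Finsupp.degree_single, add_comm]
        rw [hX, hT p (hν hp) _ hmem]
        refine Finset.sum_eq_zero fun q _ => ?_
        have hle' : (μ - Finsupp.single q 1).degree ≤ μ.degree := Finsupp.degree_mono tsub_le_self
        have hz := ih (μ - Finsupp.single q 1).degree (by omega) _ rfl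
          fun x hx => hμA (Finsupp.support_tsub hx)
        have : (monomial (μ - Finsupp.single q 1) (1 * (μ q : ℝ))) =
            (μ q : ℝ) • (monomial (μ - Finsupp.single q 1) (1 : ℝ)) := by
          rw [smul_monomial, smul_eq_mul, mul_one, one_mul]
        rw [pderiv_monomial, this, map_smul, hz, smul_zero, mul_zero]
  rw [← support_sum_monomial_coeff g, map_sum]
  refine Finset.sum_eq_zero fun ν hν => ?_
  have : monomial ν (coeff ν g) = coeff ν g • monomial ν (1 : ℝ) := by
    rw [smul_monomial, smul_eq_mul, mul_one]
  rw [this, map_smul, key _ ν rfl, smul_zero]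
  intro x hx
  exact mem_supported.1 hg ((mem_vars_iff_mem_support x).2 ⟨ν, hν, hx⟩)

theorem linearMap_eq_of_wick_recursion {c : V → V → R} (hc : ∀ p q, c p q = c q p)
    (T : MvPolynomial V ℝ →ₗ[ℝ] R) (h1 : T 1 = 1)
    (hT : ∀ p g, T (X p * g) = ∑ q, c p q * T (pderiv q g)) : T = wick c := by
  rw [← sub_eq_zero]
  refine LinearMap.ext fun g => ?_
  refine eq_zero_of_wick_recursion (A := Set.univ) c _ (by simp [h1]) (fun p _ g _ => ?_)
    (by simp)
  simp only [LinearMap.sub_apply, hT, wick_X_mul hc, mul_sub, Finset.sum_sub_distrib]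

/-- Uncorrelated groups of variables are independent. -/
theorem wick_mul_of_uncorrelated {c : V → V → R} (hc : ∀ p q, c p q = c q p) {A B : Set V}
    (hAB : ∀ p ∈ A, ∀ q ∈ B, c p q = 0) {g h : MvPolynomial V ℝ} (hg : g ∈ supported ℝ A)
    (hh : h ∈ supported ℝ B) : wick c (g * h) = wick c g * wick c h := by
  rw [← sub_eq_zero]
  -- With `h` fixed, the defect of multiplicativity obeys the recursion in `g` alone: a derivative
  -- falling on `h` vanishes for `q` outside `B`, and its coefficient `c p q` vanishes for `q` in
  -- `B`.
  let T : MvPolynomial V ℝ →ₗ[ℝ] R := wick c ∘ₗ LinearMap.mulRight ℝ h -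
    (LinearMap.mulRight ℝ (wick c h)) ∘ₗ wick c
  refine eq_zero_of_wick_recursion (A := A) c T (by simp [T]) (fun p hp g _ => ?_) hg
  simp only [T, LinearMap.sub_apply, LinearMap.comp_apply, LinearMap.mulRight_apply, mul_assoc,
    wick_X_mul hc, pderiv_mul, map_add, mul_sub, Finset.sum_sub_distrib, Finset.sum_mul]
  congr 1
  refine Finset.sum_congr rfl fun q _ => ?_
  by_cases hq : q ∈ B
  · simp [hAB p hp q hq]
  · simp [pderiv_eq_zero_of_mem_supported hh hq]

/-- The functional on polynomials in the variables from `A` only depends on their covariances. -/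
theorem wick_eq_of_eqOn {c c' : V → V → R} (hc : ∀ p q, c p q = c q p)
    (hc' : ∀ p q, c' p q = c' q p) {A : Set V} (h : ∀ p ∈ A, ∀ q ∈ A, c p q = c' p q)
    {g : MvPolynomial V ℝ} (hg : g ∈ supported ℝ A) : wick c g = wick c' g := by
  rw [← sub_eq_zero]
  refine eq_zero_of_wick_recursion (A := A) c (wick c - wick c') (by simp)
    (fun p hp g hg => ?_) hg
  simp only [LinearMap.sub_apply, wick_X_mul hc, wick_X_mul hc', mul_sub, Finset.sum_sub_distrib]
  congr 1
  refine Finset.sum_congr rfl fun q _ => ?_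
  by_cases hq : q ∈ A
  · rw [h p hp q hq]
  · simp [pderiv_eq_zero_of_mem_supported hg hq]

/-- The reason for general coefficients: covariances may be polynomials in the entries of the
coupling, and evaluation at a coupling is an algebra homomorphism. -/
theorem wick_comp_algHom {R' : Type*} [CommRing R'] [Algebra ℝ R'] (φ : R →ₐ[ℝ] R')
    {c : V → V → R} (hc : ∀ p q, c p q = c q p) (g : MvPolynomial V ℝ) :
    φ (wick c g) = wick (fun p q => φ (c p q)) g := by
  have := linearMap_eq_of_wick_recursion (c := fun p q => φ (c p q)) (fun p q => by rw [hc])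
    (φ.toLinearMap ∘ₗ wick c) (by simp)
    (fun p g => by simp [wick_X_mul hc])
  rw [← this]
  rfl

end Wick

/-! ### Gaussian expectations of polynomials -/

section Gaussian

open MvPolynomial

variable {S : Type*} [Fintype S]

/-- Powers of linear forms span the polynomials. -/
theorem eq_zero_of_forall_pow_linear (T : MvPolynomial S ℝ →ₗ[ℝ] ℝ)
    (h : ∀ (u : S → ℝ) (m : ℕ), T ((∑ s, C (u s) * X s) ^ m) = 0) : T = 0 := by
  classical
  refine (basisMonomials S ℝ).ext fun ν => ?_
  rw [coe_basisMonomials, LinearMap.zero_apply]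
  set m := ∑ s, ν s with hm
  let toF : (S → ℕ) → S →₀ ℕ := Finsupp.equivFunOnFinite.symm
  have hmon : ∀ k : S → ℕ, (∏ s, X s ^ k s : MvPolynomial S ℝ) = monomial (toF k) 1 := by
    intro k
    rw [monomial_eq, C_1, one_mul, Finsupp.prod_fintype _ _ (fun _ => pow_zero _)]
    rfl
  -- The value of `T` on the m-th power of the linear form with coefficients `u`, regarded as a
  -- polynomial in `u`. It vanishes as a function, hence coefficientwise, and each coefficient is a
  -- nonzero multinomial number times a value of `T`.
  let B : MvPolynomial S ℝ := ∑ k ∈ Finset.piAntidiag Finset.univ m,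
    monomial (toF k) ((Nat.multinomial Finset.univ k : ℝ) * T (monomial (toF k) 1))
  have hB : B = 0 := by
    refine MvPolynomial.funext fun u => ?_
    rw [map_zero, ← h u m, Finset.sum_pow_eq_sum_piAntidiag, map_sum, map_sum]
    refine Finset.sum_congr rfl fun k _ => ?_
    have h1 : ((Nat.multinomial Finset.univ k : MvPolynomial S ℝ) *
        ∏ s, (C (u s) * X s) ^ k s) =
        ((Nat.multinomial Finset.univ k : ℝ) * ∏ s, u s ^ k s) • monomial (toF k) (1 : ℝ) := by
      simp only [mul_pow, Finset.prod_mul_distrib, hmon, smul_eq_C_mul, map_mul, map_prod, map_pow,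
        map_natCast, mul_assoc]
    rw [h1, map_smul, eval_monomial, Finsupp.prod_fintype _ _ (fun _ => pow_zero _)]
    simp only [toF, Finsupp.equivFunOnFinite_symm_apply_apply, smul_eq_mul]
    ring
  have hν : coeff ν B = (Nat.multinomial Finset.univ ν : ℝ) * T (monomial ν 1) := by
    rw [coeff_sum, Finset.sum_eq_single (ν : S → ℕ)]
    · have : toF ν = ν := Finsupp.equivFunOnFinite_symm_coe ν
      rw [this, coeff_monomial, if_pos rfl]
    · intro k _ hk
      rw [coeff_monomial, if_neg]
      rintro rfl
      exact hk rfl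
    · intro hn
      exact absurd (by simp [hm]) hn
  rw [hB, coeff_zero] at hν
  have hpos : (Nat.multinomial Finset.univ ν : ℝ) ≠ 0 := by
    exact_mod_cast (Nat.multinomial_pos _ _).ne'
  exact (mul_eq_zero.1 hν.symm).resolve_left hpos

/-- The recursion for the moments of a centred one-dimensional Gaussian. -/
theorem integral_pow_gaussianReal (v : NNReal) (m : ℕ) :
    ∫ x, x ^ (m + 1) ∂gaussianReal 0 v = m * v * ∫ x, x ^ (m - 1) ∂gaussianReal 0 v := by
  set M := mgf id (gaussianReal 0 v) with hM
  have hint : ∀ t : ℝ, t ∈ interior (integrableExpSet id (gaussianReal 0 v)) := by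
    intro t
    rw [integrableExpSet_id_gaussianReal, interior_univ]
    trivial
  have hd : ∀ (k : ℕ) (t : ℝ), HasDerivAt (iteratedDeriv k M) (iteratedDeriv (k + 1) M t) t := by
    intro k t
    rw [iteratedDeriv_mgf (hint t)]
    exact hasDerivAt_iteratedDeriv_mgf (hint t) k
  -- Leibniz' rule for M' = v t M, the differential equation of exp(v t²/2). At `k = 0` the
  -- truncated index `k - 1` is harmless because of the factor `k`.
  have hrec : ∀ k : ℕ, ∀ t : ℝ, iteratedDeriv (k + 1) M t =
      v * t * iteratedDeriv k M t + k * v * iteratedDeriv (k - 1) M t := by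
    intro k
    induction k with
    | zero =>
      intro t
      have hexp : HasDerivAt M (Real.exp (0 * t + v * t ^ 2 / 2) * (v * t)) t := by
        rw [hM, mgf_id_gaussianReal]
        have h1 : HasDerivAt (fun t : ℝ => 0 * t + v * t ^ 2 / 2) (v * t) t := by
          have h0 : (fun t : ℝ => 0 * t + v * t ^ 2 / 2) = fun t => (v / 2 : ℝ) * t ^ 2 := by
            ext
            ring
          rw [h0]
          refine ((hasDerivAt_pow 2 t).const_mul _).congr_deriv ?_
          simp
          ring
        exact h1.exp
      rw [iteratedDeriv_one, hexp.deriv, iteratedDeriv_zero, hM, mgf_id_gaussianReal]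
      simp
      ring
    | succ k ih =>
      intro t
      have h1 : HasDerivAt (iteratedDeriv (k + 1) M)
          (v * iteratedDeriv k M t + v * t * iteratedDeriv (k + 1) M t +
            k * v * iteratedDeriv k M t) t := by
        have hfun : iteratedDeriv (k + 1) M = fun t =>
            v * t * iteratedDeriv k M t + k * v * iteratedDeriv (k - 1) M t := funext ih
        have ha : HasDerivAt (fun t : ℝ => (v : ℝ) * t) v t := by
          simpa using (hasDerivAt_id t).const_mul (v : ℝ)
        have hb : HasDerivAt (fun t => v * t * iteratedDeriv k M t +
            k * v * iteratedDeriv (k - 1) M t) (v * iteratedDeriv k M t +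
            v * t * iteratedDeriv (k + 1) M t + k * v * iteratedDeriv k M t) t := by
          refine ((ha.mul (hd k t)).add (HasDerivAt.const_mul ((k : ℝ) * v) (?_ : HasDerivAt
            (iteratedDeriv (k - 1) M) (if k = 0 then iteratedDeriv 1 M t else
              iteratedDeriv k M t) t))).congr_deriv ?_
          · split_ifs with h
            · subst h
              exact hd 0 t
            · obtain ⟨j, rfl⟩ := Nat.exists_eq_succ_of_ne_zero h
              exact hd j t
          · split_ifs with h
            · simp [h]
            · rfl
        rwa [← hfun] at hb
      rw [(hd (k + 1) t).unique h1, Nat.add_sub_cancel]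
      push_cast
      ring
  have hz : ∀ k, iteratedDeriv k M 0 = ∫ x, x ^ k ∂gaussianReal 0 v := fun k => by
    rw [hM, iteratedDeriv_mgf_zero (hint 0)]
    rfl
  have := hrec m 0
  rw [hz, hz, hz] at this
  simpa using this

variable {Ω : Type*} [MeasurableSpace Ω] {P : Measure Ω} {ζ : S → Ω → ℝ}

/-- Hölder with exponents 2r, 2r for a product; the exponent must therefore vary in the induction on
the polynomial. -/
theorem IsCentredGaussian.memLp_eval (h : IsCentredGaussian P ζ) (g : MvPolynomial S ℝ)
    {r : ENNReal} (hr : r ≠ ⊤) : MemLp (fun ω => eval (fun s => ζ s ω) g) r P := by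
  have := h.gaussian.isProbabilityMeasure
  induction g using MvPolynomial.induction_on generalizing r with
  | C a =>
    simp only [eval_C]
    exact memLp_const a
  | add f g hf hg =>
    simp only [map_add]
    exact (hf hr).add (hg hr)
  | mul_X g s hg =>
    simp only [map_mul, eval_X]
    have hs : MemLp (ζ s) (2 * r) P := (h.gaussian.eval s).memLp (ENNReal.mul_ne_top (by simp) hr)
    have hg' := hg (r := 2 * r) (ENNReal.mul_ne_top (by simp) hr)
    have : ENNReal.HolderTriple (2 * r) (2 * r) r := ⟨by
      rw [ENNReal.mul_inv (by simp) (by simp), ← add_mul, ENNReal.inv_two_add_inv_two, one_mul]⟩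
    exact hs.mul' hg'

theorem IsCentredGaussian.integrable_eval (h : IsCentredGaussian P ζ) (g : MvPolynomial S ℝ) :
    Integrable (fun ω => eval (fun s => ζ s ω) g) P :=
  memLp_one_iff_integrable.1 (h.memLp_eval g ENNReal.one_ne_top)

/-- The expectation as a functional on polynomials. -/
def IsCentredGaussian.expectation (h : IsCentredGaussian P ζ) : MvPolynomial S ℝ →ₗ[ℝ] ℝ where
  toFun g := ∫ ω, eval (fun s => ζ s ω) g ∂P
  map_add' f g := by
    simp only [map_add]
    exact integral_add (h.integrable_eval f) (h.integrable_eval g)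
  map_smul' a g := by
    simp only [smul_eval, RingHom.id_apply, smul_eq_mul]
    exact integral_const_mul a _

/-- Shaped to match the moment recursion of a one-dimensional Gaussian whose variance is that of the
linear form. -/
theorem wick_pow_linear {c : S → S → ℝ} (hc : ∀ p q, c p q = c q p) (u : S → ℝ) (m : ℕ) :
    wick c ((∑ s, C (u s) * X s) ^ (m + 1)) =
      m * (∑ p, ∑ q, u p * u q * c p q) * wick c ((∑ s, C (u s) * X s) ^ (m - 1)) := by
  classical
  set l : MvPolynomial S ℝ := ∑ s, C (u s) * X s with hl
  have hd : ∀ q, pderiv q l = C (u q) := by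
    intro q
    rw [hl, map_sum, Finset.sum_eq_single q]
    · simp
    · intro b _ hb
      rw [pderiv_C_mul, pderiv_X_of_ne hb, mul_zero]
    · simp
  have h1 : l ^ (m + 1) = ∑ p, u p • (X p * l ^ m) := by
    rw [pow_succ', hl, Finset.sum_mul]
    refine Finset.sum_congr rfl fun p _ => ?_
    rw [smul_eq_C_mul, mul_assoc]
  have h2 : ∀ q, pderiv q (l ^ m) = ((m : ℝ) * u q) • l ^ (m - 1) := by
    intro q
    rw [pderiv_pow, hd, smul_eq_C_mul, map_mul, map_natCast]
    ring
  rw [h1, map_sum, Finset.mul_sum, Finset.sum_mul]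
  refine Finset.sum_congr rfl fun p _ => ?_
  rw [map_smul, wick_X_mul hc, smul_eq_mul, Finset.mul_sum, Finset.mul_sum, Finset.sum_mul]
  refine Finset.sum_congr rfl fun q _ => ?_
  rw [h2, map_smul, smul_eq_mul]
  ring

/-- Wick's theorem. Powers of linear forms span all polynomials, and a linear form in the family is
a one-dimensional centred Gaussian, whose moments obey the same recursion as `wick` on those powers.
-/
theorem IsCentredGaussian.integral_eval (h : IsCentredGaussian P ζ) (g : MvPolynomial S ℝ) :
    ∫ ω, eval (fun s => ζ s ω) g ∂P = wick (fun p q => ∫ ω, ζ p ω * ζ q ω ∂P) g := by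
  set c : S → S → ℝ := fun p q => ∫ ω, ζ p ω * ζ q ω ∂P with hcdef
  have hc : ∀ p q, c p q = c q p := fun p q => by simp only [hcdef, mul_comm]
  have := h.gaussian.isProbabilityMeasure
  suffices hT : h.expectation - wick c = 0 from
    sub_eq_zero.1 (LinearMap.congr_fun hT g)
  refine eq_zero_of_forall_pow_linear _ fun u m => ?_
  rw [LinearMap.sub_apply, sub_eq_zero]
  let Y : Ω → ℝ := fun ω => ∑ s, u s * ζ s ω
  have hY : ∀ (k : ℕ) ω, eval (fun s => ζ s ω) ((∑ s, C (u s) * X s) ^ k) = Y ω ^ k := by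
    intro k ω
    simp [Y]
  have hE : ∀ k : ℕ, h.expectation ((∑ s, C (u s) * X s) ^ k) = ∫ ω, Y ω ^ k ∂P := fun k =>
    integral_congr_ae (Filter.Eventually.of_forall (hY k))
  have hYg : HasGaussianLaw Y P := by
    convert! h.gaussian.map (∑ s, u s • ContinuousLinearMap.proj (R := ℝ) (φ := fun _ : S => ℝ) s)
    ext ω
    simp [Y]
  have hmean : ∫ ω, Y ω ∂P = 0 := by
    rw [integral_finsetSum _ fun s _ => ((h.gaussian.eval s).integrable.const_mul _)]
    refine Finset.sum_eq_zero fun s _ => ?_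
    rw [integral_const_mul, h.mean_zero, mul_zero]
  have hprod : ∀ p q, Integrable (fun ω => ζ p ω * ζ q ω) P := fun p q => by
    have := h.integrable_eval (X p * X q)
    simp only [map_mul, eval_X] at this
    exact this
  have hvar : ∫ ω, Y ω ^ 2 ∂P = ∑ p, ∑ q, u p * u q * c p q := by
    have : ∀ ω, Y ω ^ 2 = ∑ p, ∑ q, u p * u q * (ζ p ω * ζ q ω) := by
      intro ω
      rw [sq, Finset.sum_mul_sum]
      refine Finset.sum_congr rfl fun p _ => Finset.sum_congr rfl fun q _ => by ring
    simp only [this]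
    rw [integral_finsetSum _ fun p _ =>
      integrable_finsetSum _ fun q _ => (hprod p q).const_mul _]
    refine Finset.sum_congr rfl fun p _ => ?_
    rw [integral_finsetSum _ fun q _ => (hprod p q).const_mul _]
    refine Finset.sum_congr rfl fun q _ => ?_
    rw [integral_const_mul]
  set w := ∑ p, ∑ q, u p * u q * c p q with hw
  have hw0 : 0 ≤ w := by
    rw [← hvar]
    exact integral_nonneg fun ω => sq_nonneg _
  have hlaw : P.map Y = gaussianReal 0 w.toNNReal := by
    rw [hYg.map_eq_gaussianReal, hmean, variance_of_integral_eq_zero hYg.aemeasurable hmean, hvar]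
  have hmom : ∀ k : ℕ, ∫ ω, Y ω ^ k ∂P = ∫ x, x ^ k ∂gaussianReal 0 w.toNNReal := by
    intro k
    rw [← hlaw, integral_map hYg.aemeasurable (by fun_prop)]
  rw [hE, hmom]
  induction m using Nat.strong_induction_on with
  | _ m ih =>
    cases m with
    | zero => simp
    | succ m =>
      rw [integral_pow_gaussianReal, wick_pow_linear hc, ih (m - 1) (by omega),
        Real.coe_toNNReal _ hw0]

theorem IsCentredGaussian.posSemidef (h : IsCentredGaussian P ζ) :
    (Matrix.of fun p q => ∫ ω, ζ p ω * ζ q ω ∂P).PosSemidef := by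
  refine Matrix.posSemidef_iff_dotProduct_mulVec.2 ⟨?_, fun u => ?_⟩
  · ext p q
    simp [Matrix.conjTranspose_apply, mul_comm]
  · have hprod : ∀ p q, Integrable (fun ω => ζ p ω * ζ q ω) P := fun p q => by
      have := h.integrable_eval (X p * X q)
      simp only [map_mul, eval_X] at this
      exact this
    have : ∫ ω, (∑ s, u s * ζ s ω) ^ 2 ∂P =
        star u ⬝ᵥ ((Matrix.of fun p q => ∫ ω, ζ p ω * ζ q ω ∂P).mulVec u) := by
      have h1 : ∀ ω, (∑ s, u s * ζ s ω) ^ 2 = ∑ p, ∑ q, u p * u q * (ζ p ω * ζ q ω) := by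
        intro ω
        rw [sq, Finset.sum_mul_sum]
        refine Finset.sum_congr rfl fun p _ => Finset.sum_congr rfl fun q _ => by ring
      simp only [h1, dotProduct, Matrix.mulVec, Matrix.of_apply]
      rw [integral_finsetSum _ fun p _ =>
        integrable_finsetSum _ fun q _ => (hprod p q).const_mul _]
      refine Finset.sum_congr rfl fun p _ => ?_
      rw [integral_finsetSum _ fun q _ => (hprod p q).const_mul _, Finset.mul_sum]
      refine Finset.sum_congr rfl fun q _ => ?_
      rw [integral_const_mul]
      simp
      ring
    rw [← this]
    exact integral_nonneg fun ω => sq_nonneg _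

/-- A centred Gaussian law exists for every positive semidefinite covariance matrix. -/
theorem exists_isCentredGaussian {C : Matrix S S ℝ} (hC : C.PosSemidef) :
    ∃ ν : Measure (S → ℝ), IsCentredGaussian ν (fun s x => x s) ∧
      ∀ p q, ∫ x, x p * x q ∂ν = C p q := by
  classical
  let μ := multivariateGaussian (0 : EuclideanSpace ℝ S) C
  let L := PiLp.continuousLinearEquiv 2 ℝ (fun _ : S => ℝ)
  have hLm : Measurable L := L.continuous.measurable
  have hint : ∀ s, ∫ x, x s ∂μ = 0 := by
    intro s
    have := (EuclideanSpace.proj (𝕜 := ℝ) s).integral_comp_id_comm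
      (IsGaussian.integrable_id (μ := μ))
    simpa [μ] using this
  refine ⟨μ.map L, ⟨⟨?_⟩, fun s => ?_⟩, fun p q => ?_⟩
  · rw [show (fun (x : S → ℝ) (s : S) => x s) = id from rfl, Measure.map_id]
    infer_instance
  · rw [integral_map hLm.aemeasurable (measurable_pi_apply s).aestronglyMeasurable]
    exact hint s
  · rw [integral_map hLm.aemeasurable (by fun_prop)]
    have h2 : ∀ s, MemLp (fun x : EuclideanSpace ℝ S => x s) 2 μ := fun s =>
      (IsGaussian.memLp_dual μ (EuclideanSpace.proj (𝕜 := ℝ) s) 2 (by simp))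
    have := covariance_eval_multivariateGaussian (μ := 0) hC p q
    rw [covariance_eq_sub (h2 p) (h2 q)] at this
    rw [← this]
    have hp := hint p
    simp only [μ] at hp
    rw [hp, zero_mul, sub_zero]
    rfl

/-- A centred Gaussian law is determined by its covariances. -/
theorem IsCentredGaussian.law_unique {ν ν' : Measure (S → ℝ)}
    (h : IsCentredGaussian ν fun s x => x s) (h' : IsCentredGaussian ν' fun s x => x s)
    (hcov : ∀ p q, ∫ x, x p * x q ∂ν = ∫ x, x p * x q ∂ν') : ν = ν' := by
  classical
  have hg : IsGaussian ν := by
    have := h.gaussian.isGaussian_map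
    rwa [show (fun (x : S → ℝ) (s : S) => x s) = id from rfl, Measure.map_id] at this
  have hg' : IsGaussian ν' := by
    have := h'.gaussian.isGaussian_map
    rwa [show (fun (x : S → ℝ) (s : S) => x s) = id from rfl, Measure.map_id] at this
  have hpoly : ∀ g : MvPolynomial S ℝ, ∫ x, eval x g ∂ν = ∫ x, eval x g ∂ν' := by
    intro g
    have h1 := h.integral_eval g
    have h2 := h'.integral_eval g
    simp only [hcov] at h1
    rw [← h2] at h1
    exact h1
  refine Measure.ext_of_charFunDual (funext fun L => ?_)
  obtain ⟨l, hL⟩ : ∃ l : MvPolynomial S ℝ, ∀ x, L x = eval x l := by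
    refine ⟨∑ s, MvPolynomial.C (L (Pi.single s 1)) * X s, fun x => ?_⟩
    have hx : x = ∑ s, x s • (Pi.single s (1 : ℝ) : S → ℝ) := by
      simpa using (pi_eq_sum_univ' x)
    conv_lhs => rw [hx, map_sum]
    simp [mul_comm]
  have hmean : ∫ x, L x ∂ν = ∫ x, L x ∂ν' := by
    simp only [hL]
    exact hpoly _
  have hsq : ∫ x, L x ^ 2 ∂ν = ∫ x, L x ^ 2 ∂ν' := by
    simp only [hL, ← map_pow]
    exact hpoly _
  -- A Gaussian characteristic function sees only the mean and variance of each linear functional,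
  -- which are integrals of polynomials.
  rw [IsGaussian.charFunDual_eq, IsGaussian.charFunDual_eq,
    variance_eq_sub (IsGaussian.memLp_dual ν L 2 (by simp)),
    variance_eq_sub (IsGaussian.memLp_dual ν' L 2 (by simp))]
  have e1 : ∀ ρ : Measure (S → ℝ), ρ[(L : (S → ℝ) → ℝ) ^ 2] = ∫ x, L x ^ 2 ∂ρ := fun ρ => rfl
  rw [e1, e1, hsq, hmean, integral_complex_ofReal, integral_complex_ofReal, hmean]

end Gaussian

/-- Existence rests on Schur's product theorem: the prescribed covariance is the entrywise product
of two positive semidefinite matrices. -/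
theorem existsUnique_recoupling {n N : ℕ} {Ω : Type*} [MeasurableSpace Ω] {P : Measure Ω}
    {ζ : Var n N → Ω → ℝ} (hζ : IsCentredGaussian P ζ) {Q : Matrix (Fin n) (Fin n) ℝ}
    (hQ : Q ∈ couplings n) :
    ∃! ν : Measure (Var n N → ℝ), IsRecoupling P ζ Q ν fun p x => x p := by
  have hC := (hQ.1.submatrix (fun p : Var n N => p.1)).hadamard hζ.posSemidef
  obtain ⟨ν, hν, hcov⟩ := exists_isCentredGaussian hC
  refine ⟨ν, ⟨hν, fun p q => ?_⟩, fun ν' hν' => ?_⟩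
  · rw [hcov]
    rfl
  · refine hν'.centred.law_unique hν fun p q => ?_
    rw [hν'.covariance, hcov]
    rfl

/-! ### Blocks of partitions and joins -/

section Partitions

variable {n : ℕ}

/-- Two points lie in a common block. -/
def SameBlock (Ψ : SetPart n) (i j : Fin n) : Prop := ∃ A ∈ Ψ.parts, i ∈ A ∧ j ∈ A

/-- A bond lies inside a block. -/
def InBlock (Ψ : SetPart n) (e : Sym2 (Fin n)) : Prop := ∃ B ∈ Ψ.parts, ∀ i ∈ e, i ∈ B

theorem inBlock_mk {Ψ : SetPart n} {i j : Fin n} : InBlock Ψ s(i, j) ↔ SameBlock Ψ i j := by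
  simp [InBlock, SameBlock]

theorem sameBlock_iff_part_eq {Ψ : SetPart n} {i j : Fin n} :
    SameBlock Ψ i j ↔ Ψ.part i = Ψ.part j := by
  rw [SameBlock, ← Ψ.mem_part_iff_exists,
    Ψ.mem_part_iff_part_eq_part (Finset.mem_univ _) (Finset.mem_univ _)]

theorem SameBlock.refl (Ψ : SetPart n) (i : Fin n) : SameBlock Ψ i i :=
  sameBlock_iff_part_eq.2 rfl

theorem SameBlock.symm {Ψ : SetPart n} {i j : Fin n} (h : SameBlock Ψ i j) : SameBlock Ψ j i :=
  sameBlock_iff_part_eq.2 (sameBlock_iff_part_eq.1 h).symm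

theorem SameBlock.trans {Ψ : SetPart n} {i j k : Fin n} (h : SameBlock Ψ i j)
    (h' : SameBlock Ψ j k) : SameBlock Ψ i k :=
  sameBlock_iff_part_eq.2 ((sameBlock_iff_part_eq.1 h).trans (sameBlock_iff_part_eq.1 h'))

theorem inBlock_of_isDiag (Ψ : SetPart n) {e : Sym2 (Fin n)} (he : e.IsDiag) : InBlock Ψ e := by
  induction e using Sym2.ind with
  | _ a b =>
    rw [Sym2.mk_isDiag_iff] at he
    subst he
    exact inBlock_mk.2 (SameBlock.refl Ψ a)

theorem le_iff_sameBlock {Θ Ψ : SetPart n} :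
    Θ ≤ Ψ ↔ ∀ i j, SameBlock Θ i j → SameBlock Ψ i j := by
  constructor
  · rintro h i j ⟨A, hA, hi, hj⟩
    obtain ⟨B, hB, hAB⟩ := h hA
    exact ⟨B, hB, hAB hi, hAB hj⟩
  · intro h A hA
    obtain ⟨i, hi⟩ := Θ.nonempty_of_mem_parts hA
    refine ⟨Ψ.part i, Ψ.part_mem.2 (Finset.mem_univ _), fun j hj => ?_⟩
    exact Ψ.mem_part_iff_exists.2 (h j i ⟨A, hA, hj, hi⟩)

theorem InBlock.mono {Θ Ψ : SetPart n} (h : Θ ≤ Ψ) {e : Sym2 (Fin n)} (he : InBlock Θ e) :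
    InBlock Ψ e := by
  obtain ⟨A, hA, hA'⟩ := he
  obtain ⟨B, hB, hAB⟩ := h hA
  exact ⟨B, hB, fun i hi => hAB (hA' i hi)⟩

theorem sameBlock_top (i j : Fin n) : SameBlock (⊤ : SetPart n) i j := by
  have h : ∀ k : Fin n, (⊤ : SetPart n).part k = Finset.univ := by
    intro k
    have := Finpartition.parts_top_subset (Finset.univ : Finset (Fin n))
      ((⊤ : SetPart n).part_mem.2 (Finset.mem_univ k))
    simpa using this
  rw [sameBlock_iff_part_eq, h, h]

theorem sameBlock_inf {Θ Ψ : SetPart n} {i j : Fin n} :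
    SameBlock (Θ ⊓ Ψ) i j ↔ SameBlock Θ i j ∧ SameBlock Ψ i j := by
  constructor
  · intro h
    exact ⟨le_iff_sameBlock.1 inf_le_left i j h, le_iff_sameBlock.1 inf_le_right i j h⟩
  · rintro ⟨⟨A, hA, hiA, hjA⟩, ⟨B, hB, hiB, hjB⟩⟩
    refine ⟨A ∩ B, ?_, Finset.mem_inter.2 ⟨hiA, hiB⟩, Finset.mem_inter.2 ⟨hjA, hjB⟩⟩
    rw [Finpartition.parts_inf, Finset.mem_erase]
    refine ⟨?_, Finset.mem_image.2 ⟨(A, B), Finset.mem_product.2 ⟨hA, hB⟩, rfl⟩⟩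
    exact Finset.ne_empty_of_mem (Finset.mem_inter.2 ⟨hiA, hiB⟩)

theorem sameBlock_finset_inf {s : Finset (SetPart n)} {i j : Fin n} :
    SameBlock (s.inf id) i j ↔ ∀ Ψ ∈ s, SameBlock Ψ i j := by
  classical
  induction s using Finset.induction_on with
  | empty => simp [sameBlock_top]
  | insert Ψ s _ ih => rw [Finset.inf_insert, sameBlock_inf, ih, Finset.forall_mem_insert, id]

theorem sameBlock_join {Γ : Finset (Sym2 (Fin n))} {Θ : SetPart n} {i j : Fin n} :
    SameBlock (join Γ Θ) i j ↔
      ∀ Ψ : SetPart n, Θ ≤ Ψ → (∀ e ∈ Γ, InBlock Ψ e) → SameBlock Ψ i j := by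
  rw [join, sameBlock_finset_inf]
  simp only [Finset.mem_filter, Finset.mem_univ, true_and, and_imp]
  rfl

/-- The universal property of the join. The meet defining it is itself an admissible partition,
because two points share a block of a meet exactly when they share a block of every partition in it.
-/
theorem join_le_iff {Γ : Finset (Sym2 (Fin n))} {Θ Ψ : SetPart n} :
    join Γ Θ ≤ Ψ ↔ Θ ≤ Ψ ∧ ∀ e ∈ Γ, InBlock Ψ e := by
  have hle : Θ ≤ join Γ Θ := le_iff_sameBlock.2 fun i j hij =>
    sameBlock_join.2 fun Ψ hΨ _ => le_iff_sameBlock.1 hΨ i j hij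
  have hin : ∀ e ∈ Γ, InBlock (join Γ Θ) e := by
    intro e he
    induction e using Sym2.ind with
    | _ a b => exact inBlock_mk.2 (sameBlock_join.2 fun Ψ _ hΨ => inBlock_mk.1 (hΨ _ he))
  constructor
  · exact fun h => ⟨hle.trans h, fun e he => (hin e he).mono h⟩
  · rintro ⟨h1, h2⟩
    exact le_iff_sameBlock.2 fun i j hij => sameBlock_join.1 hij Ψ h1 h2

theorem le_join (Γ : Finset (Sym2 (Fin n))) (Θ : SetPart n) : Θ ≤ join Γ Θ :=
  (join_le_iff.1 le_rfl).1

theorem inBlock_join {Γ : Finset (Sym2 (Fin n))} (Θ : SetPart n) {e : Sym2 (Fin n)} (he : e ∈ Γ) :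
    InBlock (join Γ Θ) e :=
  (join_le_iff.1 le_rfl).2 e he

@[simp]
theorem join_empty (Θ : SetPart n) : join ∅ Θ = Θ :=
  eq_of_forall_ge_iff fun Ψ => by simp [join_le_iff]

theorem join_insert [DecidableEq (Sym2 (Fin n))] (e : Sym2 (Fin n)) (Γ : Finset (Sym2 (Fin n)))
    (Θ : SetPart n) : join (insert e Γ) Θ = join Γ (join {e} Θ) :=
  eq_of_forall_ge_iff fun Ψ => by
    simp only [join_le_iff, Finset.forall_mem_insert, Finset.mem_singleton, forall_eq, and_assoc]

theorem join_singleton_of_inBlock {e : Sym2 (Fin n)} {Θ : SetPart n} (h : InBlock Θ e) :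
    join {e} Θ = Θ :=
  le_antisymm (join_le_iff.2 ⟨le_rfl, by simpa using h⟩) (le_join _ _)

/-- Joining two distinct blocks lowers the number of blocks by one. -/
theorem card_join_singleton {e : Sym2 (Fin n)} {Θ : SetPart n} (h : ¬ InBlock Θ e) :
    (join {e} Θ).parts.card + 1 = Θ.parts.card := by
  classical
  induction e using Sym2.ind with
  | _ a b =>
    rw [inBlock_mk, sameBlock_iff_part_eq] at h
    set A := Θ.part a with hA
    set B := Θ.part b with hB
    have hAm : A ∈ Θ.parts := Θ.part_mem.2 (Finset.mem_univ _)
    have hBm : B ∈ Θ.parts := Θ.part_mem.2 (Finset.mem_univ _)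
    have haA : a ∈ A := Θ.mem_part (Finset.mem_univ _)
    have hbB : b ∈ B := Θ.mem_part (Finset.mem_univ _)
    let parts : Finset (Finset (Fin n)) := insert (A ∪ B) ((Θ.parts.erase A).erase B)
    have hmem : ∀ i : Fin n, ∀ D ∈ parts, i ∈ D →
        D = if Θ.part i = A ∨ Θ.part i = B then A ∪ B else Θ.part i := by
      intro i D hD hi
      rcases Finset.mem_insert.1 hD with rfl | hD
      · rw [if_pos]
        rcases Finset.mem_union.1 hi with hi | hi
        · exact Or.inl (Θ.part_eq_of_mem hAm hi)
        · exact Or.inr (Θ.part_eq_of_mem hBm hi)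
      · obtain ⟨h1, hD⟩ := Finset.mem_erase.1 hD
        obtain ⟨h2, hD⟩ := Finset.mem_erase.1 hD
        rw [Θ.part_eq_of_mem hD hi, if_neg (by tauto)]
    let Ψ : SetPart n := Finpartition.ofExistsUnique parts (fun p _ => Finset.subset_univ _)
      (by
        intro i _
        by_cases hi : Θ.part i = A ∨ Θ.part i = B
        · refine ⟨A ∪ B, ⟨Finset.mem_insert_self _ _, ?_⟩, fun D hD => ?_⟩
          · rcases hi with hi | hi
            · exact Finset.mem_union_left _ (hi ▸ Θ.mem_part (Finset.mem_univ _))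
            · exact Finset.mem_union_right _ (hi ▸ Θ.mem_part (Finset.mem_univ _))
          · rw [hmem i D hD.1 hD.2, if_pos hi]
        · refine ⟨Θ.part i, ⟨Finset.mem_insert_of_mem ?_, Θ.mem_part (Finset.mem_univ _)⟩,
            fun D hD => ?_⟩
          · push Not at hi
            exact Finset.mem_erase.2 ⟨hi.2, Finset.mem_erase.2
              ⟨hi.1, Θ.part_mem.2 (Finset.mem_univ _)⟩⟩
          · rw [hmem i D hD.1 hD.2, if_neg hi])
      (by
        intro h0
        rcases Finset.mem_insert.1 h0 with h0 | h0
        · exact Finset.notMem_empty a (h0 ▸ Finset.mem_union_left _ haA)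
        · exact Θ.empty_notMem_parts (Finset.mem_of_mem_erase (Finset.mem_of_mem_erase h0)))
    have hΨ : Ψ.parts = parts := rfl
    have hU : A ∪ B ∈ Ψ.parts := hΨ ▸ Finset.mem_insert_self _ _
    have hjoin : join {s(a, b)} Θ = Ψ := by
      apply le_antisymm
      · refine join_le_iff.2 ⟨fun D hD => ?_, ?_⟩
        · by_cases h1 : D = A
          · exact ⟨_, hU, h1 ▸ Finset.subset_union_left⟩
          by_cases h2 : D = B
          · exact ⟨_, hU, h2 ▸ Finset.subset_union_right⟩
          exact ⟨D, Finset.mem_insert_of_mem (Finset.mem_erase.2 ⟨h2, Finset.mem_erase.2 ⟨h1, hD⟩⟩),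
            le_rfl⟩
        · simp only [Finset.mem_singleton, forall_eq, inBlock_mk]
          exact ⟨_, hU, Finset.mem_union_left _ haA, Finset.mem_union_right _ hbB⟩
      · have hle := le_join {s(a, b)} Θ
        have hab : SameBlock (join {s(a, b)} Θ) a b :=
          inBlock_mk.1 (inBlock_join Θ (Finset.mem_singleton_self _))
        have hall : ∀ i ∈ A ∪ B, SameBlock (join {s(a, b)} Θ) i a := by
          intro i hi
          rcases Finset.mem_union.1 hi with hi | hi
          · exact le_iff_sameBlock.1 hle i a ⟨A, hAm, hi, haA⟩
          · exact (le_iff_sameBlock.1 hle i b ⟨B, hBm, hi, hbB⟩).trans hab.symm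
        intro D hD
        rcases Finset.mem_insert.1 hD with rfl | hD
        · exact ⟨(join {s(a, b)} Θ).part a, Finpartition.part_mem _ |>.2 (Finset.mem_univ _),
            fun i hi => (Finpartition.mem_part_iff_exists _).2 (hall i hi)⟩
        · exact hle (Finset.mem_of_mem_erase (Finset.mem_of_mem_erase hD))
    have hnot : A ∪ B ∉ (Θ.parts.erase A).erase B := by
      intro hm
      have hm' := Finset.mem_of_mem_erase (Finset.mem_of_mem_erase hm)
      have h1 := Θ.part_eq_of_mem hm' (Finset.mem_union_left B haA)
      have h2 := Θ.part_eq_of_mem hm' (Finset.mem_union_right A hbB)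
      exact h (h1.trans h2.symm)
    have hBe : B ∈ Θ.parts.erase A := Finset.mem_erase.2 ⟨fun hBA => h hBA.symm, hBm⟩
    rw [hjoin, hΨ, Finset.card_insert_of_notMem hnot, Finset.card_erase_of_mem hBe,
      Finset.card_erase_of_mem hAm]
    have : 1 < Θ.parts.card := Finset.one_lt_card.2 ⟨A, hAm, B, hBm, h⟩
    omega

/-- Each bond lowers the number of blocks by at most one, so a tree has no bond to waste. -/
theorem card_le_card_join (Γ : Finset (Sym2 (Fin n))) (Θ : SetPart n) :
    Θ.parts.card ≤ (join Γ Θ).parts.card + Γ.card := by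
  classical
  induction Γ using Finset.induction_on generalizing Θ with
  | empty => simp
  | insert e Γ he ih =>
    rw [join_insert, Finset.card_insert_of_notMem he]
    have := ih (join {e} Θ)
    by_cases h : InBlock Θ e
    · rw [join_singleton_of_inBlock h] at this ⊢
      omega
    · have := card_join_singleton h
      omega

/-- Only an inequality, since for `n = 0` there is no block at all. -/
theorem card_top_le : (⊤ : SetPart n).parts.card ≤ 1 := by
  simpa using Finset.card_le_card (Finpartition.parts_top_subset (Finset.univ : Finset (Fin n)))

theorem eq_top_of_card_eq_one {Θ : SetPart n} (h : Θ.parts.card = 1) : Θ = ⊤ := by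
  refine le_antisymm le_top (le_iff_sameBlock.2 fun i j _ => sameBlock_iff_part_eq.2 ?_)
  exact Finset.card_le_one.1 h.le _ (Θ.part_mem.2 (Finset.mem_univ _)) _
    (Θ.part_mem.2 (Finset.mem_univ _))

/-- A sequence of bonds each of which joins two distinct blocks of the partition obtained so far,
and which ends in the one-block partition. -/
def JoinsUp : (m : ℕ) → SetPart n → (Fin m → Sym2 (Fin n)) → Prop
  | 0, Θ, _ => Θ = ⊤
  | m + 1, Θ, e => ¬ InBlock Θ (e 0) ∧ JoinsUp m (join {e 0} Θ) (Fin.tail e)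

/-- The partitions only coarsen along the sequence, so a bond that still joins two blocks later did
so at the start. This excludes diagonal pairs and repetitions. -/
theorem JoinsUp.not_inBlock {m : ℕ} {Θ : SetPart n} {e : Fin m → Sym2 (Fin n)}
    (h : JoinsUp m Θ e) (α : Fin m) : ¬ InBlock Θ (e α) := by
  induction m generalizing Θ with
  | zero => exact α.elim0
  | succ m ih =>
    refine Fin.cases h.1 (fun β hβ => ?_) α
    exact ih h.2 β (hβ.mono (le_join _ _))

theorem image_univ_succ [DecidableEq (Sym2 (Fin n))] {m : ℕ} (e : Fin (m + 1) → Sym2 (Fin n)) :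
    Finset.univ.image e = insert (e 0) (Finset.univ.image (Fin.tail e)) := by
  ext x
  simp [Fin.exists_fin_succ, Fin.tail, eq_comm]

theorem JoinsUp.injective {m : ℕ} {Θ : SetPart n} {e : Fin m → Sym2 (Fin n)}
    (h : JoinsUp m Θ e) : Function.Injective e := by
  induction m generalizing Θ with
  | zero => exact fun α => α.elim0
  | succ m ih =>
    have h0 : ∀ β : Fin m, e β.succ ≠ e 0 := fun β hβ =>
      h.2.not_inBlock β (hβ ▸ inBlock_join Θ (Finset.mem_singleton_self _))
    intro α β
    refine Fin.cases ?_ (fun α => ?_) α <;> refine Fin.cases ?_ (fun β => ?_) β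
    · simp
    · exact fun hh => absurd hh.symm (h0 β)
    · exact fun hh => absurd hh (h0 α)
    · exact fun hh => congrArg Fin.succ (ih h.2 hh)

/-- Order is irrelevant: any enumeration of a tree merges two blocks at every step, because the
number of bonds is the least that can reach the one-block partition. -/
theorem joinsUp_iff_mem_trees {m : ℕ} {Θ : SetPart n} (hΘ : Θ.parts.card = m + 1)
    (e : Fin m → Sym2 (Fin n)) : JoinsUp m Θ e ↔ Finset.univ.image e ∈ trees Θ := by
  classical
  constructor
  · intro h
    rw [trees, Finset.mem_filter, Finset.mem_powerset]
    refine ⟨fun x hx => ?_, ?_, ?_⟩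
    · obtain ⟨α, -, rfl⟩ := Finset.mem_image.1 hx
      exact Finset.mem_filter.2 ⟨Finset.mem_univ _, fun hd =>
        h.not_inBlock α (inBlock_of_isDiag Θ hd)⟩
    · induction m generalizing Θ with
      | zero =>
        rw [Finset.univ_eq_empty, Finset.image_empty, join_empty]
        exact h
      | succ m ih =>
        rw [image_univ_succ, join_insert]
        have := card_join_singleton h.1
        exact ih (by omega) _ h.2
    · rw [Finset.card_image_of_injective _ h.injective, hΘ, Finset.card_univ, Fintype.card_fin]
  · intro h
    rw [trees, Finset.mem_filter, Finset.mem_powerset] at h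
    obtain ⟨hb, ht, hc⟩ := h
    induction m generalizing Θ with
    | zero => exact eq_top_of_card_eq_one hΘ
    | succ m ih =>
      have hi : Function.Injective e := by
        rw [← Set.injOn_univ, ← Finset.coe_univ, ← Finset.card_image_iff, Finset.card_univ,
          Fintype.card_fin]
        omega
      have hit : Function.Injective (Fin.tail e) := hi.comp (Fin.succ_injective m)
      rw [image_univ_succ, join_insert] at ht
      have hcard : (Finset.univ.image (Fin.tail e)).card = m := by
        rw [Finset.card_image_of_injective _ hit, Finset.card_univ, Fintype.card_fin]
      -- Otherwise the other `m` bonds would have to reduce `m + 2` blocks to one.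
      have h0 : ¬ InBlock Θ (e 0) := by
        intro h0
        rw [join_singleton_of_inBlock h0] at ht
        have h1 := card_le_card_join (Finset.univ.image (Fin.tail e)) Θ
        have h2 := card_top_le (n := n)
        rw [ht, hcard] at h1
        omega
      have h1 := card_join_singleton h0
      refine ⟨h0, ih (by omega) _ (fun x hx => hb ?_) ht (by rw [hcard]; omega)⟩
      rw [image_univ_succ]
      exact Finset.mem_insert_of_mem hx

end Partitions

/-! ### Integration over the simplex -/

section Simplex

open Set
open scoped Pointwise

theorem measurableSet_simplex (m : ℕ) : MeasurableSet (simplex m) := by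
  have : simplex m = (⋂ (i : Fin m) (j : Fin m) (_ : i < j), {t | t j < t i}) ∩
      ⋂ α, {t | t α ∈ Ioo (0 : ℝ) 1} := by
    ext t
    simp only [simplex, mem_ofPred_eq, mem_inter_iff, mem_iInter]
    rfl
  rw [this]
  refine MeasurableSet.inter ?_ ?_
  · refine MeasurableSet.iInter fun i => MeasurableSet.iInter fun j =>
      MeasurableSet.iInter fun _ => ?_
    exact measurableSet_lt (measurable_pi_apply j) (measurable_pi_apply i)
  · exact MeasurableSet.iInter fun α => measurable_pi_apply α measurableSet_Ioo

theorem simplex_subset_Icc (m : ℕ) : simplex m ⊆ Icc 0 1 :=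
  fun _ ht => ⟨fun α => (ht.2 α).1.le, fun α => (ht.2 α).2.le⟩

theorem integrableOn_simplex {m : ℕ} {H : (Fin m → ℝ) → ℝ} (hH : Continuous H) :
    IntegrableOn H (simplex m) :=
  (hH.continuousOn.integrableOn_compact isCompact_Icc).mono_set (simplex_subset_Icc m)

theorem cons_mem_simplex_iff {m : ℕ} {t : ℝ} {s : Fin m → ℝ} :
    (Fin.cons t s : Fin (m + 1) → ℝ) ∈ simplex (m + 1) ↔ t ∈ Ioo (0 : ℝ) 1 ∧ s ∈ t • simplex m := by
  constructor
  · rintro ⟨h1, h2⟩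
    have ht : t ∈ Ioo (0 : ℝ) 1 := by simpa using h2 0
    have hst : ∀ α, s α < t := fun α => by simpa using h1 (Fin.succ_pos α)
    refine ⟨ht, (mem_smul_set_iff_inv_smul_mem₀ ht.1.ne' _ _).2 ⟨fun α β hαβ => ?_, fun α => ?_⟩⟩
    · have : s β < s α := by simpa using h1 (Fin.succ_lt_succ_iff.2 hαβ)
      simpa using mul_lt_mul_of_pos_left this (inv_pos.2 ht.1)
    · have h0 : 0 < s α := by simpa using (h2 α.succ).1
      refine ⟨mul_pos (inv_pos.2 ht.1) h0, ?_⟩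
      simpa [inv_mul_lt_one₀ ht.1] using hst α
  · rintro ⟨ht, hs⟩
    obtain ⟨u, ⟨h1, h2⟩, rfl⟩ := hs
    have hlt : ∀ α, t * u α < t := fun α => mul_lt_of_lt_one_right ht.1 (h2 α).2
    constructor
    · intro α β
      refine Fin.cases ?_ (fun α => ?_) α <;> refine Fin.cases ?_ (fun β => ?_) β
      · simp
      · intro _
        simpa using hlt β
      · simp
      · intro hαβ
        simpa using mul_lt_mul_of_pos_left (h1 (Fin.succ_lt_succ_iff.1 hαβ)) ht.1
    · intro α
      refine Fin.cases ?_ (fun α => ?_) α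
      · simpa using ht
      · have := mul_pos ht.1 (h2 α).1
        simpa using ⟨this, (hlt α).trans ht.2⟩

/-- Splitting off the largest coordinate of a point of the simplex. -/
theorem integral_simplex_succ {m : ℕ} {H : (Fin (m + 1) → ℝ) → ℝ} (hH : Continuous H) :
    IntegrableOn (fun t : ℝ => t ^ m * ∫ s in simplex m, H (Fin.cons t (t • s))) (Ioo 0 1) ∧
    ∫ t in simplex (m + 1), H t =
      ∫ t in Ioo (0 : ℝ) 1, t ^ m * ∫ s in simplex m, H (Fin.cons t (t • s)) := by
  let e := (MeasurableEquiv.piFinSuccAbove (fun _ : Fin (m + 1) => ℝ) 0).symm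
  have he : MeasurePreserving e :=
    (volume_preserving_piFinSuccAbove (fun _ : Fin (m + 1) => ℝ) 0).symm _
  have he' : ∀ t s, e (t, s) = (Fin.cons t s : Fin (m + 1) → ℝ) := fun t s => by
    change Fin.insertNth (α := fun _ => ℝ) 0 t s = _
    rw [Fin.insertNth_zero']
  let G : ℝ × (Fin m → ℝ) → ℝ := fun x => (simplex (m + 1)).indicator H (e x)
  have hG : Integrable G := by
    refine (he.integrable_comp_emb e.measurableEmbedding (g := (simplex (m + 1)).indicator H)).2 ?_
    exact (integrable_indicator_iff (measurableSet_simplex _)).2 (integrableOn_simplex hH)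
  have hI : ∫ t in simplex (m + 1), H t = ∫ x, G x := by
    rw [← integral_indicator (measurableSet_simplex _)]
    exact (he.integral_comp e.measurableEmbedding _).symm
  have hinner : (fun t : ℝ => ∫ s, G (t, s)) = (Ioo (0 : ℝ) 1).indicator
      (fun t : ℝ => t ^ m * ∫ s in simplex m, H (Fin.cons t (t • s))) := by
    ext t
    by_cases ht : t ∈ Ioo (0 : ℝ) 1
    · have hGt : (fun s => G (t, s)) = (t • simplex m).indicator fun s => H (Fin.cons t s) := by
        ext s
        have hiff : (Fin.cons t s : Fin (m + 1) → ℝ) ∈ simplex (m + 1) ↔ s ∈ t • simplex m := by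
          rw [cons_mem_simplex_iff, and_iff_right ht]
        simp only [G, he']
        by_cases hs : s ∈ t • simplex m
        · rw [indicator_of_mem hs, indicator_of_mem (hiff.2 hs)]
        · rw [indicator_of_notMem hs, indicator_of_notMem (mt hiff.1 hs)]
      have hms : MeasurableSet (t • simplex m) :=
        (measurableSet_simplex m).const_smul_of_ne_zero ht.1.ne'
      -- Below the largest coordinate `t` lies a copy of the smaller simplex scaled by `t`; the
      -- scaling produces the Jacobian `t ^ m`.
      rw [indicator_of_mem ht, hGt, integral_indicator hms,
        Measure.setIntegral_comp_smul_of_pos volume (fun s => H (Fin.cons t s)) _ ht.1,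
        Module.finrank_fintype_fun_eq_card, Fintype.card_fin, smul_eq_mul, ← mul_assoc,
        mul_inv_cancel₀ (pow_ne_zero _ ht.1.ne'), one_mul]
    · rw [indicator_of_notMem ht]
      have : (fun s => G (t, s)) = fun _ => 0 := by
        ext s
        simp only [G, he']
        exact indicator_of_notMem (fun hs => ht (cons_mem_simplex_iff.1 hs).1) _
      rw [this, integral_zero]
  have hG' : Integrable G ((volume : Measure ℝ).prod volume) := hG
  constructor
  · rw [← integrable_indicator_iff measurableSet_Ioo, ← hinner]
    exact hG'.integral_prod_left
  · rw [hI, Measure.volume_eq_prod, integral_prod _ hG', hinner,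
      integral_indicator measurableSet_Ioo]

/-- Splitting off the largest coordinate multiplies the volume by the integral of `t ^ m` over the
unit interval, that is, by 1/(m+1). -/
theorem volume_simplex (m : ℕ) : volume (simplex m) = ENNReal.ofReal (1 / (m.factorial : ℝ)) := by
  have hfin : volume (simplex m) ≠ ⊤ :=
    (measure_mono_top (simplex_subset_Icc m)).mt isCompact_Icc.measure_lt_top.ne
  rw [← ENNReal.ofReal_toReal hfin]
  congr 1
  change volume.real (simplex m) = _
  have hone : ∀ k, ∫ _ in simplex k, (1 : ℝ) = volume.real (simplex k) := fun k => by simp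
  clear hfin
  induction m with
  | zero =>
    have : simplex 0 = univ := eq_univ_of_forall fun t =>
      ⟨fun α => α.elim0, fun α => α.elim0⟩
    rw [this, Measure.real, volume_pi, Measure.pi_univ]
    simp
  | succ m ih =>
    rw [← hone, (integral_simplex_succ continuous_const).2, hone, ih, integral_mul_const,
      ← integral_Ioc_eq_integral_Ioo, ← intervalIntegral.integral_of_le zero_le_one, integral_pow,
      Nat.factorial_succ]
    push_cast
    field_simp
    simp

end Simplex

/-! ### The tree measures are probability measures on the set of couplings -/

section TreeMeasure

variable {n m : ℕ}

theorem continuous_pathMatrix (Θ : SetPart n) (e : Fin m → Sym2 (Fin n)) :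
    Continuous (pathMatrix Θ e) := by
  unfold pathMatrix
  fun_prop

/-- Self-similarity of the paths: after rescaling by the first parameter, a path matrix lies on the
segment from `[Θ]` to a path matrix of the partition already joined along the first bond. Both the
induction on blocks and positivity rest on this. -/
theorem pathMatrix_cons (Θ : SetPart n) (e : Fin (m + 1) → Sym2 (Fin n)) (t : ℝ)
    (s : Fin m → ℝ) :
    pathMatrix Θ e (Fin.cons t (t • s)) =
      (1 - t) • partMatrix Θ + t • pathMatrix (join {e 0} Θ) (Fin.tail e) s := by
  have h1 : ∀ β : Fin m, (Finset.Iic β.succ).image e =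
      insert (e 0) ((Finset.Iic β).image (Fin.tail e)) := by
    intro β
    ext x
    simp [Fin.exists_fin_succ, Fin.tail, eq_comm]
  have h2 : ∀ β : Fin m, (Finset.Iio β.succ).image e =
      insert (e 0) ((Finset.Iio β).image (Fin.tail e)) := by
    intro β
    ext x
    simp [Fin.exists_fin_succ, Fin.tail, eq_comm]
  have h3 : (Finset.Iic (0 : Fin (m + 1))).image e = {e 0} := by
    ext x
    simp [eq_comm]
  have h4 : (Finset.Iio (0 : Fin (m + 1))).image e = ∅ := by
    ext x
    simp
  rw [pathMatrix, Fin.sum_univ_succ, pathMatrix, h3, h4, join_empty]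
  simp only [h1, h2, join_insert, Fin.cons_zero, Fin.cons_succ, Pi.smul_apply, smul_eq_mul,
    mul_smul]
  rw [← Finset.smul_sum, smul_add, smul_sub, sub_smul, one_smul]
  abel

theorem partMatrix_apply (Ψ : SetPart n) (i j : Fin n) [Decidable (SameBlock Ψ i j)] :
    partMatrix Ψ i j = if SameBlock Ψ i j then 1 else 0 := by
  rw [partMatrix, Matrix.of_apply]
  congr

/-- Positivity holds because the matrix is the identity matrix indexed by blocks, pulled back along
the map from points to their blocks. -/
theorem partMatrix_mem_couplings (Ψ : SetPart n) : partMatrix Ψ ∈ couplings n := by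
  classical
  refine ⟨?_, fun i j => ?_, fun i => ?_⟩
  · have : partMatrix Ψ =
        (1 : Matrix (Finset (Fin n)) (Finset (Fin n)) ℝ).submatrix Ψ.part Ψ.part := by
      ext i j
      rw [partMatrix_apply, Matrix.submatrix_apply, Matrix.one_apply]
      simp only [sameBlock_iff_part_eq]
    rw [this]
    exact Matrix.PosSemidef.one.submatrix _
  · rw [partMatrix_apply]
    split_ifs <;> simp
  · rw [partMatrix_apply, if_pos (SameBlock.refl Ψ i)]

theorem convex_couplings (n : ℕ) : Convex ℝ (couplings n) := by
  intro Q hQ Q' hQ' a b ha hb hab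
  refine ⟨(hQ.1.smul ha).add (hQ'.1.smul hb), fun i j => ?_, fun i => ?_⟩
  · exact convex_Icc (0 : ℝ) 1 (hQ.2.1 i j) (hQ'.2.1 i j) ha hb hab
  · simp [hQ.2.2 i, hQ'.2.2 i, hab]

theorem pathMatrix_mem_couplings (Θ : SetPart n) (e : Fin m → Sym2 (Fin n)) {t : Fin m → ℝ}
    (ht : t ∈ simplex m) : pathMatrix Θ e t ∈ couplings n := by
  induction m generalizing Θ with
  | zero =>
    rw [pathMatrix, Finset.univ_eq_empty, Finset.sum_empty, add_zero]
    exact partMatrix_mem_couplings Θ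
  | succ m ih =>
    rw [← Fin.cons_self_tail t] at ht ⊢
    obtain ⟨h0, s, hs, hst⟩ := cons_mem_simplex_iff.1 ht
    rw [← hst]
    change pathMatrix Θ e (Fin.cons (t 0) (t 0 • s)) ∈ _
    rw [pathMatrix_cons]
    exact convex_couplings n (partMatrix_mem_couplings Θ) (ih _ _ hs)
      (sub_nonneg.2 h0.2.le) h0.1.le (sub_add_cancel _ _)

/-- A map from `m` indices onto a set of `m` elements is a bijection. The count m! cancels the
volume 1/m! of the simplex and makes the tree measures probability measures. -/
theorem card_enumerations {β : Type*} [Fintype β] [DecidableEq β] {Γ : Finset β}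
    (hΓ : Γ.card = m) :
    (Finset.univ.filter fun e : Fin m → β => Finset.univ.image e = Γ).card = m.factorial := by
  have hcard : Fintype.card (Fin m) = Fintype.card Γ := by simp [hΓ]
  have : Fintype.card (Fin m ≃ Γ) = m.factorial := by
    rw [Fintype.card_equiv (Fintype.equivOfCardEq hcard), Fintype.card_fin]
  rw [← this, ← Finset.card_univ]
  symm
  refine Finset.card_bij (fun σ _ i => (σ i : β)) ?_ ?_ ?_
  · intro σ _
    rw [Finset.mem_filter]
    refine ⟨Finset.mem_univ _, ?_⟩
    ext x
    simp only [Finset.mem_image, Finset.mem_univ, true_and]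
    exact ⟨fun ⟨i, hi⟩ => hi ▸ (σ i).2, fun hx => ⟨σ.symm ⟨x, hx⟩, by simp⟩⟩
  · intro σ _ τ _ h
    ext i
    exact congrFun h i
  · intro e he
    have he := (Finset.mem_filter.1 he).2
    let g : Fin m → Γ := fun i => ⟨e i, he ▸ Finset.mem_image_of_mem e (Finset.mem_univ i)⟩
    have hg : Function.Surjective g := by
      rintro ⟨x, hx⟩
      rw [← he] at hx
      obtain ⟨i, -, hi⟩ := Finset.mem_image.1 hx
      exact ⟨i, Subtype.ext hi⟩
    exact ⟨Equiv.ofBijective g ((Fintype.bijective_iff_surjective_and_card g).2 ⟨hg, hcard⟩),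
      Finset.mem_univ _, rfl⟩

theorem isProbabilityMeasure_treeMeasure {Θ : SetPart n} {Γ : Finset (Sym2 (Fin n))}
    (hΓ : Γ ∈ trees Θ) : IsProbabilityMeasure (treeMeasure Θ Γ) := by
  have hcard : Γ.card = Θ.parts.card - 1 := by
    have := (Finset.mem_filter.1 hΓ).2.2
    omega
  constructor
  have h : ∀ e : Fin (Θ.parts.card - 1) → Sym2 (Fin n),
      (((volume : Measure (Fin (Θ.parts.card - 1) → ℝ)).restrict (simplex _)).map
        (pathMatrix Θ e)) Set.univ = ENNReal.ofReal (1 / ((Θ.parts.card - 1).factorial : ℝ)) := by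
    intro e
    rw [Measure.map_apply (continuous_pathMatrix Θ e).measurable MeasurableSet.univ,
      Set.preimage_univ, Measure.restrict_apply_univ, volume_simplex]
  rw [treeMeasure, Measure.finsetSum_apply, Finset.sum_congr rfl fun e _ => h e,
    Finset.sum_const, card_enumerations hcard, nsmul_eq_mul, ← ENNReal.ofReal_natCast,
    ← ENNReal.ofReal_mul (by positivity), mul_one_div_cancel (by positivity), ENNReal.ofReal_one]

/-- Closedness provides the measurability needed to transfer almost sure membership through an image
measure. -/
theorem isClosed_couplings (n : ℕ) : IsClosed (couplings n) := by
  have : couplings n = {Q | Q.PosSemidef} ∩ ((⋂ i, ⋂ j, {Q | Q i j ∈ Set.Icc (0 : ℝ) 1}) ∩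
      ⋂ i, {Q | Q i i = 1}) := by
    ext Q
    simp [couplings]
  rw [this]
  refine IsClosed.inter ?_ (IsClosed.inter ?_ ?_)
  · simp only [Matrix.posSemidef_iff_dotProduct_mulVec, Set.ofPred_and]
    refine IsClosed.inter ?_ ?_
    · exact isClosed_eq (f := fun Q : Matrix (Fin n) (Fin n) ℝ => Q.conjTranspose)
        (by fun_prop) continuous_id
    · simp only [Set.ofPred_forall]
      refine isClosed_iInter fun x => isClosed_le continuous_const ?_
      fun_prop
  · exact isClosed_iInter fun i => isClosed_iInter fun j =>
      isClosed_Icc.preimage (by fun_prop)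
  · exact isClosed_iInter fun i => isClosed_eq (by fun_prop) continuous_const

theorem ae_mem_couplings (Θ : SetPart n) (Γ : Finset (Sym2 (Fin n))) :
    ∀ᵐ Q ∂treeMeasure Θ Γ, Q ∈ couplings n := by
  rw [treeMeasure, ae_finsetSum_measure_iff]
  intro e _
  rw [ae_map_iff (p := fun Q => Q ∈ couplings n) (continuous_pathMatrix Θ e).measurable.aemeasurable
    (isClosed_couplings n).measurableSet]
  filter_upwards [ae_restrict_mem (measurableSet_simplex _)] with t ht
  exact pathMatrix_mem_couplings Θ e ht

/-- Continuous functions are integrable against the tree measures, with the defining value. -/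
theorem integral_treeMeasure (Θ : SetPart n) (Γ : Finset (Sym2 (Fin n)))
    {G : Matrix (Fin n) (Fin n) ℝ → ℝ} (hG : Continuous G) :
    Integrable G (treeMeasure Θ Γ) ∧
    ∫ Q, G Q ∂treeMeasure Θ Γ = ∑ e ∈ Finset.univ.filter
      (fun e : Fin (Θ.parts.card - 1) → Sym2 (Fin n) => Finset.univ.image e = Γ),
        ∫ t in simplex _, G (pathMatrix Θ e t) := by
  have hint : ∀ e : Fin (Θ.parts.card - 1) → Sym2 (Fin n), Integrable G
      (((volume : Measure (Fin (Θ.parts.card - 1) → ℝ)).restrict (simplex _)).map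
        (pathMatrix Θ e)) := by
    intro e
    rw [integrable_map_measure hG.measurable.aestronglyMeasurable
      (continuous_pathMatrix Θ e).measurable.aemeasurable]
    exact integrableOn_simplex (hG.comp (continuous_pathMatrix Θ e))
  refine ⟨integrable_finsetSum_measure.2 fun e _ => hint e, ?_⟩
  rw [treeMeasure, integral_finsetSum_measure fun e _ => hint e]
  refine Finset.sum_congr rfl fun e _ => ?_
  rw [integral_map (continuous_pathMatrix Θ e).measurable.aemeasurable
    hG.measurable.aestronglyMeasurable]

end TreeMeasure

/-! ### Surjective colourings -/

section Surjections

/-- The number of surjections from a `k`-element set onto a `p`-element set. -/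
def surjCount (k p : ℕ) : ℕ := Nat.card {c : Fin k → Fin p // Function.Surjective c}

theorem card_surjective {S : Type*} [Fintype S] (p : ℕ) :
    Nat.card {c : S → Fin p // Function.Surjective c} = surjCount (Fintype.card S) p := by
  let σ := Fintype.equivFin S
  refine Nat.card_congr ((Equiv.arrowCongr σ (Equiv.refl _)).subtypeEquiv fun c => ?_)
  simp [Equiv.arrowCongr]

theorem surjCount_zero_zero : surjCount 0 0 = 1 := by
  rw [surjCount, Nat.card_eq_one_iff_unique]
  exact ⟨⟨fun a b => Subtype.ext (Subsingleton.elim _ _)⟩, ⟨⟨id, fun x => x.elim0⟩⟩⟩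

theorem surjCount_succ_zero (k : ℕ) : surjCount (k + 1) 0 = 0 := by
  have : IsEmpty {c : Fin (k + 1) → Fin 0 // Function.Surjective c} := ⟨fun c => (c.1 0).elim0⟩
  exact Nat.card_of_isEmpty

theorem surjCount_of_lt {k p : ℕ} (h : k < p) : surjCount k p = 0 := by
  have : IsEmpty {c : Fin k → Fin p // Function.Surjective c} := ⟨fun c => by
    have := Fintype.card_le_of_surjective c.1 c.2
    simp only [Fintype.card_fin] at this
    omega⟩
  exact Nat.card_of_isEmpty

/-- Condition on the value `v` of the first element: the remaining elements either still reach `v`,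
or map onto the other `p` values. -/
theorem surjCount_succ_succ (k p : ℕ) :
    surjCount (k + 1) (p + 1) = (p + 1) * (surjCount k (p + 1) + surjCount k p) := by
  classical
  have hsurj : ∀ (v : Fin (p + 1)) (c : Fin k → Fin (p + 1)),
      Function.Surjective (Fin.cons v c : Fin (k + 1) → Fin (p + 1)) ↔
        ∀ y, y ≠ v → ∃ i, c i = y := by
    intro v c
    constructor
    · intro h y hy
      obtain ⟨i, hi⟩ := h y
      revert hi
      refine Fin.cases (fun h0 => ?_) (fun j hj => ?_) i
      · exact absurd h0.symm hy
      · exact ⟨j, hj⟩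
    · intro h y
      by_cases hy : y = v
      · exact ⟨0, hy.symm⟩
      · obtain ⟨i, hi⟩ := h y hy
        exact ⟨i.succ, hi⟩
  let A : Fin (p + 1) → Type := fun v => {c : Fin k → Fin (p + 1) // ∀ y, y ≠ v → ∃ i, c i = y}
  have hA : surjCount (k + 1) (p + 1) = ∑ v, Nat.card (A v) := by
    rw [surjCount, ← Nat.card_sigma]
    refine Nat.card_congr (Equiv.trans ?_ (Equiv.subtypeProdEquivSigmaSubtype
      (fun (v : Fin (p + 1)) (c : Fin k → Fin (p + 1)) => ∀ y, y ≠ v → ∃ i, c i = y)))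
    exact ((Fin.consEquiv fun _ : Fin (k + 1) => Fin (p + 1)).subtypeEquiv
      fun x => (hsurj x.1 x.2).symm).symm
  have hB : ∀ v, Nat.card (A v) = surjCount k (p + 1) + surjCount k p := by
    intro v
    let pr : A v → Prop := fun c => ∃ i, c.1 i = v
    have e1 : {c : A v // pr c} ≃ {c : Fin k → Fin (p + 1) // Function.Surjective c} :=
      { toFun := fun c => ⟨c.1.1, fun y => by
          by_cases hy : y = v
          · rw [hy]
            exact c.2
          · exact c.1.2 y hy⟩
        invFun := fun c => ⟨⟨c.1, fun y _ => c.2 y⟩, c.2 v⟩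
        left_inv := fun c => rfl
        right_inv := fun c => rfl }
    have e2 : {c : Fin k → Fin p // Function.Surjective c} ≃ {c : A v // ¬ pr c} := by
      refine Equiv.ofBijective (fun c => ⟨⟨fun i => v.succAbove (c.1 i), fun y hy => ?_⟩, ?_⟩)
        ⟨fun c d h => ?_, fun c => ?_⟩
      · obtain ⟨z, rfl⟩ := Fin.exists_succAbove_eq hy
        obtain ⟨i, hi⟩ := c.2 z
        exact ⟨i, congrArg v.succAbove hi⟩
      · rintro ⟨i, hi⟩
        exact Fin.succAbove_ne v _ hi
      · refine Subtype.ext (funext fun i => Fin.succAbove_right_injective (p := v) ?_)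
        exact congrFun (congrArg (fun x : {c : A v // ¬ pr c} => x.1.1) h) i
      · have hne : ∀ i, c.1.1 i ≠ v := fun i hi => c.2 ⟨i, hi⟩
        choose d hd using fun i => Fin.exists_succAbove_eq (hne i)
        refine ⟨⟨d, fun z => ?_⟩, Subtype.ext (Subtype.ext (funext hd))⟩
        obtain ⟨i, hi⟩ := c.1.2 (v.succAbove z) (Fin.succAbove_ne v z)
        exact ⟨i, Fin.succAbove_right_injective (p := v) ((hd i).trans hi)⟩
    rw [Nat.card_congr (Equiv.sumCompl pr).symm, Nat.card_sum, Nat.card_congr e1,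
      ← Nat.card_congr e2]
    rfl
  rw [hA, Finset.sum_congr rfl fun v _ => hB v]
  simp

/-- The coefficients of the logarithm sum to zero over all surjective colourings of a set with more
than one element. -/
theorem sum_log_surjCount {k N : ℕ} (hN : k < N) :
    ∑ p ∈ Finset.range (N + 1), PowerSeries.coeff p (PowerSeries.log ℝ) * surjCount (k + 1) p =
      if k = 0 then 1 else 0 := by
  have hlog : ∀ p : ℕ, PowerSeries.coeff (p + 1) (PowerSeries.log ℝ) =
      (-1) ^ p / ((p : ℝ) + 1) := by
    intro p
    rw [PowerSeries.coeff_log, if_neg (Nat.succ_ne_zero p)]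
    simp [pow_succ]
  -- The denominator of the logarithm coefficient cancels the factor `p + 1` in the recursion for
  -- surjections, and the sum telescopes. The end term dies once `M` exceeds `k`.
  have htel : ∀ M : ℕ, ∑ p ∈ Finset.range (M + 1),
      PowerSeries.coeff p (PowerSeries.log ℝ) * surjCount (k + 1) p =
        surjCount k 0 - (-1) ^ M * surjCount k M := by
    intro M
    induction M with
    | zero => simp
    | succ M ih =>
      rw [Finset.sum_range_succ, ih, hlog, surjCount_succ_succ]
      push_cast
      have : ((M : ℝ) + 1) ≠ 0 := by positivity
      field_simp
      ring
  rw [htel, surjCount_of_lt hN]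
  cases k with
  | zero => simp [surjCount_zero_zero]
  | succ k => simp [surjCount_succ_zero]

end Surjections

/-! ### Colourings constant on the blocks of a partition -/

section Colourings

variable {n : ℕ}

open scoped Classical in
/-- The partition into colour classes. -/
def colourPart {p : ℕ} (c : Fin n → Fin p) : SetPart n := Finpartition.ofSetoid (Setoid.ker c)

theorem sameBlock_colourPart {p : ℕ} {c : Fin n → Fin p} {i j : Fin n} :
    SameBlock (colourPart c) i j ↔ c i = c j := by
  classical
  rw [SameBlock, ← Finpartition.mem_part_iff_exists, colourPart,
    Finpartition.mem_part_ofSetoid_iff_rel]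
  exact eq_comm

open scoped Classical in
/-- The surjective colourings that are constant on the blocks of `Θ`. -/
def colourings (Θ : SetPart n) (p : ℕ) : Finset (Fin n → Fin p) :=
  Finset.univ.filter fun c => Function.Surjective c ∧ Θ ≤ colourPart c

theorem mem_colourings {Θ : SetPart n} {p : ℕ} {c : Fin n → Fin p} :
    c ∈ colourings Θ p ↔ Function.Surjective c ∧ Θ ≤ colourPart c := by
  simp [colourings]

/-- The block containing a point. -/
def blockOf (Θ : SetPart n) (i : Fin n) : {A // A ∈ Θ.parts} :=
  ⟨Θ.part i, Θ.part_mem.2 (Finset.mem_univ i)⟩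

theorem blockOf_eq_iff {Θ : SetPart n} {i : Fin n} {A : {A // A ∈ Θ.parts}} :
    blockOf Θ i = A ↔ i ∈ A.1 := by
  rw [Subtype.ext_iff]
  exact Θ.part_eq_iff_mem A.2

theorem blockOf_surjective (Θ : SetPart n) : Function.Surjective (blockOf Θ) := fun A => by
  obtain ⟨i, hi⟩ := Θ.nonempty_of_mem_parts A.2
  exact ⟨i, blockOf_eq_iff.2 hi⟩

open scoped Classical in
theorem sum_colourings {M : Type*} [AddCommMonoid M] (Θ : SetPart n) (p : ℕ)
    (φ : (Fin n → Fin p) → M) :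
    ∑ c ∈ colourings Θ p, φ c = ∑ d ∈ Finset.univ.filter
      (fun d : {A // A ∈ Θ.parts} → Fin p => Function.Surjective d), φ (d ∘ blockOf Θ) := by
  symm
  refine Finset.sum_bij (fun d _ => d ∘ blockOf Θ) ?_ ?_ ?_ fun _ _ => rfl
  · intro d hd
    refine mem_colourings.2 ⟨(Finset.mem_filter.1 hd).2.comp (blockOf_surjective Θ), ?_⟩
    refine le_iff_sameBlock.2 fun i j hij => sameBlock_colourPart.2 ?_
    exact congrArg d (Subtype.ext (sameBlock_iff_part_eq.1 hij))
  · intro d _ d' _ h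
    exact (blockOf_surjective Θ).injective_comp_right h
  · intro c hc
    obtain ⟨hs, hle⟩ := mem_colourings.1 hc
    have hcomp : (fun A => c (Function.surjInv (blockOf_surjective Θ) A)) ∘ blockOf Θ = c := by
      ext i
      have : SameBlock Θ (Function.surjInv (blockOf_surjective Θ) (blockOf Θ i)) i :=
        sameBlock_iff_part_eq.2 (congrArg Subtype.val
          (Function.surjInv_eq (blockOf_surjective Θ) (blockOf Θ i)))
      exact congrArg Fin.val (sameBlock_colourPart.1 (le_iff_sameBlock.1 hle _ _ this))
    refine ⟨fun A => c (Function.surjInv (blockOf_surjective Θ) A), ?_, hcomp⟩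
    refine Finset.mem_filter.2 ⟨Finset.mem_univ _, ?_⟩
    rw [← hcomp] at hs
    exact hs.of_comp

theorem card_colourings (Θ : SetPart n) (p : ℕ) :
    (colourings Θ p).card = surjCount Θ.parts.card p := by
  classical
  have h := sum_colourings Θ p fun _ => (1 : ℕ)
  rw [Finset.sum_const, Finset.sum_const, smul_eq_mul, smul_eq_mul, mul_one, mul_one] at h
  rw [h, ← Fintype.card_coe Θ.parts, ← card_surjective, Nat.card_eq_fintype_card,
    Fintype.card_subtype]

/-- The range up to `n` serves all partitions at once, as none has more than `n` blocks. -/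
theorem sum_log_card_colourings {Θ : SetPart n} {m : ℕ} (hΘ : Θ.parts.card = m + 1) :
    ∑ p ∈ Finset.range (n + 1), PowerSeries.coeff p (PowerSeries.log ℝ) * (colourings Θ p).card =
      if m = 0 then 1 else 0 := by
  simp only [card_colourings, hΘ]
  refine sum_log_surjCount ?_
  have := Θ.card_parts_le_card
  rw [Finset.card_univ, Fintype.card_fin] at this
  omega

end Colourings

/-! ### The interpolation formula for polynomials in the entries of a coupling -/

section Calculus

open MvPolynomial

variable {σ : Type*}

theorem continuous_eval_comp {X : Type*} [TopologicalSpace X] {u : X → σ → ℝ} (hu : Continuous u)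
    (F : MvPolynomial σ ℝ) : Continuous fun x => eval (u x) F := by
  induction F using MvPolynomial.induction_on with
  | C a => simpa using continuous_const
  | add f g hf hg =>
    simp only [map_add]
    exact hf.add hg
  | mul_X f s hf =>
    simp only [map_mul, eval_X]
    exact hf.mul ((continuous_apply s).comp hu)

/-- The point `(1 - t) x + t y` on the segment from `x` to `y`. -/
def segPoint (x y : σ → ℝ) (t : ℝ) : σ → ℝ := fun s => (1 - t) * x s + t * y s

theorem continuous_segPoint (x y : σ → ℝ) : Continuous (segPoint x y) := by
  unfold segPoint
  fun_prop

theorem hasDerivAt_eval_segPoint [Fintype σ] (x y : σ → ℝ) (F : MvPolynomial σ ℝ) (t : ℝ) :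
    HasDerivAt (fun t => eval (segPoint x y t) F)
      (∑ s, (y s - x s) * eval (segPoint x y t) (pderiv s F)) t := by
  classical
  induction F using MvPolynomial.induction_on with
  | C a => simpa using hasDerivAt_const t a
  | add f g hf hg =>
    simp only [map_add, mul_add, Finset.sum_add_distrib]
    exact hf.add hg
  | mul_X f r hf =>
    have hr : HasDerivAt (fun t => segPoint x y t r) (y r - x r) t := by
      have h1 : HasDerivAt (fun t : ℝ => (1 - t) * x r + t * y r) (-1 * x r + 1 * y r) t :=
        (((hasDerivAt_id t).const_sub 1).mul_const _).add ((hasDerivAt_id t).mul_const _)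
      exact h1.congr_deriv (by ring)
    simp only [map_mul, eval_X]
    refine (hf.mul hr).congr_deriv ?_
    have : ∀ s, (y s - x s) * eval (segPoint x y t) (pderiv s (f * X r)) =
        (y s - x s) * eval (segPoint x y t) (pderiv s f) * segPoint x y t r +
          if s = r then eval (segPoint x y t) f * (y r - x r) else 0 := by
      intro s
      rw [pderiv_mul, pderiv_X, map_add, map_mul, map_mul, eval_X]
      split_ifs with h
      · subst h
        simp
        ring
      · rw [Pi.single_eq_of_ne (Ne.symm h)]
        simp
        ring
    rw [Finset.sum_congr rfl fun s _ => this s, Finset.sum_add_distrib, ← Finset.sum_mul,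
      Finset.sum_ite_eq' Finset.univ r, if_pos (Finset.mem_univ r)]

theorem integrableOn_Ioo_eval_segPoint (x y : σ → ℝ) (F : MvPolynomial σ ℝ) :
    IntegrableOn (fun t => eval (segPoint x y t) F) (Set.Ioo 0 1) :=
  ((continuous_eval_comp (continuous_segPoint x y) F).continuousOn.integrableOn_compact
    isCompact_Icc).mono_set Set.Ioo_subset_Icc_self

/-- The fundamental theorem of calculus along the segment. -/
theorem sum_integral_eval_pderiv_segPoint [Fintype σ] (x y : σ → ℝ) (F : MvPolynomial σ ℝ) :
    ∑ s, (y s - x s) * ∫ t in Set.Ioo (0 : ℝ) 1, eval (segPoint x y t) (pderiv s F) =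
      eval y F - eval x F := by
  have hcont : Continuous fun t => ∑ s, (y s - x s) * eval (segPoint x y t) (pderiv s F) :=
    continuous_finsetSum _ fun s _ =>
      continuous_const.mul (continuous_eval_comp (continuous_segPoint x y) _)
  have h := intervalIntegral.integral_eq_sub_of_hasDerivAt
    (fun t _ => hasDerivAt_eval_segPoint x y F t) (hcont.intervalIntegrable 0 1)
  have h0 : segPoint x y 0 = x := by ext s; simp [segPoint]
  have h1 : segPoint x y 1 = y := by ext s; simp [segPoint]
  rw [h0, h1, intervalIntegral.integral_of_le zero_le_one, integral_Ioc_eq_integral_Ioo,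
    integral_finsetSum _ fun s _ => (integrableOn_Ioo_eval_segPoint x y _).const_mul _] at h
  rw [← h]
  exact Finset.sum_congr rfl fun s _ => (integral_const_mul _ _).symm

/-- The substitution `F ↦ F ((1 - t) x + t ·)`. -/
def shift (x : σ → ℝ) (t : ℝ) : MvPolynomial σ ℝ →ₐ[ℝ] MvPolynomial σ ℝ :=
  aeval fun s => C ((1 - t) * x s) + C t * X s

theorem eval_shift (x y : σ → ℝ) (t : ℝ) (F : MvPolynomial σ ℝ) :
    eval y (shift x t F) = eval (segPoint x y t) F := by
  induction F using MvPolynomial.induction_on with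
  | C a => simp [shift]
  | add f g hf hg => simp [hf, hg]
  | mul_X f r hf =>
    rw [map_mul, map_mul, hf, map_mul]
    simp [shift, segPoint]

theorem pderiv_shift (x : σ → ℝ) (t : ℝ) (s : σ) (F : MvPolynomial σ ℝ) :
    pderiv s (shift x t F) = t • shift x t (pderiv s F) := by
  classical
  induction F using MvPolynomial.induction_on with
  | C a => simp [shift]
  | add f g hf hg => simp [hf, hg]
  | mul_X f r hf =>
    have hr : pderiv s (shift x t (X r)) = t • shift x t (pderiv s (X r)) := by
      rw [shift, aeval_X, map_add, pderiv_C, zero_add, pderiv_C_mul, pderiv_X, Pi.single_apply]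
      split_ifs
      · simp [smul_eq_C_mul]
      · simp
    rw [map_mul, pderiv_mul, hf, hr, pderiv_mul, map_add, map_mul, map_mul, smul_add,
      smul_mul_assoc, mul_smul_comm]

/-- The iterated derivative along a sequence of variables. -/
def iterDeriv : (m : ℕ) → (Fin m → σ) → MvPolynomial σ ℝ → MvPolynomial σ ℝ
  | 0, _, F => F
  | m + 1, e, F => iterDeriv m (Fin.tail e) (pderiv (e 0) F)

theorem iterDeriv_smul {m : ℕ} (e : Fin m → σ) (a : ℝ) (F : MvPolynomial σ ℝ) :
    iterDeriv m e (a • F) = a • iterDeriv m e F := by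
  induction m generalizing F with
  | zero => rfl
  | succ m ih => rw [iterDeriv, iterDeriv, Derivation.map_smul, ih]

/-- The chain rule factor `t ^ m` is the one that later absorbs the Jacobian of the simplex. -/
theorem iterDeriv_shift {m : ℕ} (e : Fin m → σ) (x : σ → ℝ) (t : ℝ) (F : MvPolynomial σ ℝ) :
    iterDeriv m e (shift x t F) = t ^ m • shift x t (iterDeriv m e F) := by
  induction m generalizing F with
  | zero => simp [iterDeriv]
  | succ m ih => rw [iterDeriv, pderiv_shift, iterDeriv_smul, ih, smul_smul, iterDeriv, pow_succ']

end Calculus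

/-! ### Tree sums equal sums over colourings -/

section Interpolation

open MvPolynomial

variable {n m : ℕ}

/-- The entries of a matrix, symmetrized, as a function on unordered pairs. -/
def entries (Q : Matrix (Fin n) (Fin n) ℝ) : Sym2 (Fin n) → ℝ :=
  Sym2.lift ⟨fun i j => (Q i j + Q j i) / 2, fun i j => by simp only [add_comm]⟩

theorem entries_mk (Q : Matrix (Fin n) (Fin n) ℝ) (i j : Fin n) :
    entries Q s(i, j) = (Q i j + Q j i) / 2 := rfl

theorem continuous_entries : Continuous (entries (n := n)) := by
  refine continuous_pi fun e => ?_
  induction e using Sym2.ind with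
  | _ i j =>
    simp only [entries_mk]
    fun_prop

theorem entries_of_mem_couplings {Q : Matrix (Fin n) (Fin n) ℝ} (hQ : Q ∈ couplings n)
    (i j : Fin n) : entries Q s(i, j) = Q i j := by
  have : Q j i = Q i j := by simpa using hQ.1.isHermitian.apply i j
  rw [entries_mk, this]
  ring

open scoped Classical in
theorem entries_partMatrix (Ψ : SetPart n) (e : Sym2 (Fin n)) :
    entries (partMatrix Ψ) e = if InBlock Ψ e then 1 else 0 := by
  induction e using Sym2.ind with
  | _ i j =>
    rw [entries_of_mem_couplings (partMatrix_mem_couplings Ψ), partMatrix_apply]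
    simp only [inBlock_mk]

theorem entries_pathMatrix_cons (Θ : SetPart n) (e : Fin (m + 1) → Sym2 (Fin n)) (t : ℝ)
    (s : Fin m → ℝ) :
    entries (pathMatrix Θ e (Fin.cons t (t • s))) = segPoint (entries (partMatrix Θ))
      (entries (pathMatrix (join {e 0} Θ) (Fin.tail e) s)) t := by
  ext x
  rw [pathMatrix_cons]
  induction x using Sym2.ind with
  | _ i j =>
    simp only [entries_mk, segPoint, Matrix.add_apply, Matrix.smul_apply, smul_eq_mul]
    ring

open scoped Classical in
/-- The sum over all trees of the integrals of the derivatives of `F` along the tree. -/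
def treeSum (m : ℕ) (Θ : SetPart n) (F : MvPolynomial (Sym2 (Fin n)) ℝ) : ℝ :=
  ∑ e ∈ Finset.univ.filter (JoinsUp m Θ),
    ∫ t in simplex m, eval (entries (pathMatrix Θ e t)) (iterDeriv m e F)

/-- The value of `F` at the partition into colour classes. -/
def colourValue (F : MvPolynomial (Sym2 (Fin n)) ℝ) {p : ℕ} (c : Fin n → Fin p) : ℝ :=
  eval (entries (partMatrix (colourPart c))) F

/-- The cumulant functional, as a sum over surjective colourings. -/
def colourSum (Θ : SetPart n) (F : MvPolynomial (Sym2 (Fin n)) ℝ) : ℝ :=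
  ∑ p ∈ Finset.range (n + 1), PowerSeries.coeff p (PowerSeries.log ℝ) *
    ∑ c ∈ colourings Θ p, colourValue F c

/-- With one block only the colouring by a single colour survives, and both sides are the value of
`F` at `[Θ]`. -/
theorem treeSum_zero_eq_colourSum {Θ : SetPart n} (hΘ : Θ.parts.card = 1)
    (F : MvPolynomial (Sym2 (Fin n)) ℝ) : treeSum 0 Θ F = colourSum Θ F := by
  classical
  have htop := eq_top_of_card_eq_one hΘ
  have hpath : ∀ (e : Fin 0 → Sym2 (Fin n)) (t : Fin 0 → ℝ), pathMatrix Θ e t = partMatrix Θ := by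
    intro e t
    simp [pathMatrix]
  have hvol : volume.real (simplex 0) = 1 := by
    simp [Measure.real, volume_simplex]
  have hL : treeSum 0 Θ F = eval (entries (partMatrix Θ)) F := by
    have : Finset.univ.filter (JoinsUp 0 Θ) = Finset.univ :=
      Finset.filter_true_of_mem fun e _ => htop
    rw [treeSum, this]
    simp [hpath, iterDeriv, hvol]
  have hR : ∀ p, ∑ c ∈ colourings Θ p, colourValue F c =
      (colourings Θ p).card * eval (entries (partMatrix Θ)) F := by
    intro p
    rw [← nsmul_eq_mul, ← Finset.sum_const]
    refine Finset.sum_congr rfl fun c hc => ?_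
    have : colourPart c = Θ := le_antisymm (htop ▸ le_top) (mem_colourings.1 hc).2
    rw [colourValue, this]
  rw [hL, colourSum]
  simp only [hR, ← mul_assoc]
  rw [← Finset.sum_mul, sum_log_card_colourings hΘ, if_pos rfl, one_mul]

-- The first bond `b` and the largest simplex coordinate `t` are held fixed. The rest is a tree sum
-- over the joined partition, the Jacobian being absorbed by the derivatives of the rescaled
-- polynomial.
open scoped Classical in
theorem treeSum_succ (Θ : SetPart n) (F : MvPolynomial (Sym2 (Fin n)) ℝ) :
    treeSum (m + 1) Θ F = ∑ b ∈ Finset.univ.filter (fun b => ¬ InBlock Θ b),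
      ∫ t in Set.Ioo (0 : ℝ) 1,
        treeSum m (join {b} Θ) (shift (entries (partMatrix Θ)) t (pderiv b F)) := by
  rw [treeSum, Finset.sum_filter, ← (Fin.consEquiv fun _ : Fin (m + 1) => Sym2 (Fin n)).sum_comp,
    Fintype.sum_prod_type, Finset.sum_filter]
  refine Finset.sum_congr rfl fun b _ => ?_
  by_cases hb : InBlock Θ b
  · rw [if_neg (not_not.2 hb)]
    refine Finset.sum_eq_zero fun e _ => if_neg fun h => ?_
    exact h.1 hb
  rw [if_pos hb]
  have hcont : ∀ e : Fin (m + 1) → Sym2 (Fin n), Continuous fun t : Fin (m + 1) → ℝ =>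
      eval (entries (pathMatrix Θ e t)) (iterDeriv (m + 1) e F) := fun e =>
    continuous_eval_comp (continuous_entries.comp (continuous_pathMatrix Θ e)) _
  have hterm : ∀ (e : Fin m → Sym2 (Fin n)) (t : ℝ),
      t ^ m * ∫ s in simplex m, eval (entries (pathMatrix Θ
        (Fin.cons b e : Fin (m + 1) → Sym2 (Fin n)) (Fin.cons t (t • s))))
          (iterDeriv (m + 1) (Fin.cons b e : Fin (m + 1) → Sym2 (Fin n)) F) =
      ∫ s in simplex m, eval (entries (pathMatrix (join {b} Θ) e s))
        (iterDeriv m e (shift (entries (partMatrix Θ)) t (pderiv b F))) := by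
    intro e t
    rw [← integral_const_mul]
    refine integral_congr_ae (Filter.Eventually.of_forall fun s => ?_)
    simp only [entries_pathMatrix_cons, iterDeriv_shift, iterDeriv, Fin.cons_zero, Fin.tail_cons,
      smul_eval, eval_shift]
  have hfub := fun e : Fin m → Sym2 (Fin n) =>
    integral_simplex_succ (hcont (Fin.cons b e : Fin (m + 1) → Sym2 (Fin n)))
  simp only [hterm] at hfub
  simp only [treeSum]
  rw [integral_finsetSum _ fun e _ => (hfub e).1, Finset.sum_filter]
  refine Finset.sum_congr rfl fun e _ => ?_
  have hiff : JoinsUp (m + 1) Θ (Fin.cons b e : Fin (m + 1) → Sym2 (Fin n)) ↔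
      JoinsUp m (join {b} Θ) e := by
    rw [JoinsUp, Fin.cons_zero, Fin.tail_cons, and_iff_right hb]
  by_cases he : JoinsUp m (join {b} Θ) e
  · rw [if_pos he]
    refine (if_pos (hiff.2 he)).trans ?_
    exact (hfub e).2
  · rw [if_neg he]
    exact if_neg (mt hiff.1 he)

/-- The interpolation formula: the tree sum computes the cumulant functional. -/
theorem treeSum_eq_colourSum {Θ : SetPart n} (hΘ : Θ.parts.card = m + 1)
    (F : MvPolynomial (Sym2 (Fin n)) ℝ) : treeSum m Θ F = colourSum Θ F := by
  classical
  induction m generalizing Θ F with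
  | zero => exact treeSum_zero_eq_colourSum hΘ F
  | succ m ih =>
    set x := entries (partMatrix Θ) with hx
    let y : ∀ {p : ℕ}, (Fin n → Fin p) → Sym2 (Fin n) → ℝ := fun c =>
      entries (partMatrix (colourPart c))
    let J : ∀ {p : ℕ}, (Fin n → Fin p) → Sym2 (Fin n) → ℝ := fun c b =>
      ∫ t in Set.Ioo (0 : ℝ) 1, eval (segPoint x (y c) t) (pderiv b F)
    have hint : ∀ b, ¬ InBlock Θ b →
        ∫ t in Set.Ioo (0 : ℝ) 1, treeSum m (join {b} Θ) (shift x t (pderiv b F)) =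
          ∑ p ∈ Finset.range (n + 1), PowerSeries.coeff p (PowerSeries.log ℝ) *
            ∑ c ∈ colourings (join {b} Θ) p, J c b := by
      intro b hb
      have hcard := card_join_singleton hb
      have h1 : ∀ t : ℝ, treeSum m (join {b} Θ) (shift x t (pderiv b F)) =
          ∑ p ∈ Finset.range (n + 1), PowerSeries.coeff p (PowerSeries.log ℝ) *
            ∑ c ∈ colourings (join {b} Θ) p, eval (segPoint x (y c) t) (pderiv b F) := by
        intro t
        rw [ih (by omega), colourSum]
        simp only [colourValue, eval_shift, y]
      simp only [h1]
      rw [integral_finsetSum _ fun p _ => Integrable.const_mul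
        (integrable_finsetSum _ fun c _ => integrableOn_Ioo_eval_segPoint x (y c) _) _]
      refine Finset.sum_congr rfl fun p _ => ?_
      rw [integral_const_mul,
        integral_finsetSum _ fun c _ => integrableOn_Ioo_eval_segPoint x (y c) _]
    -- Exchanging bonds and colourings turns the sum over bonds into the segment formula from `[Θ]`
    -- to the matrix of the colour classes.
    have hcol : ∀ p, ∑ b ∈ Finset.univ.filter (fun b => ¬ InBlock Θ b),
        ∑ c ∈ colourings (join {b} Θ) p, J c b =
        ∑ c ∈ colourings Θ p, (colourValue F c - eval x F) := by
      intro p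
      -- Since `x b = 0`, the increment `y c b - x b` is the indicator that `b` is monochromatic,
      -- which singles out the colourings of the joined partition.
      have h2 : ∀ b, ¬ InBlock Θ b → ∑ c ∈ colourings (join {b} Θ) p, J c b =
          ∑ c ∈ colourings Θ p, (y c b - x b) * J c b := by
        intro b hb
        have hfil : colourings (join {b} Θ) p =
            (colourings Θ p).filter fun c => InBlock (colourPart c) b := by
          ext c
          simp [mem_colourings, join_le_iff, and_assoc]
        rw [hfil, Finset.sum_filter]
        refine Finset.sum_congr rfl fun c _ => ?_
        simp only [hx, y, entries_partMatrix, if_neg hb]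
        split_ifs <;> simp
      have h3 : ∀ b, InBlock Θ b → ∑ c ∈ colourings Θ p, (y c b - x b) * J c b = 0 := by
        intro b hb
        refine Finset.sum_eq_zero fun c hc => ?_
        simp only [hx, y, entries_partMatrix, if_pos hb,
          if_pos (hb.mono (mem_colourings.1 hc).2), sub_self, zero_mul]
      rw [Finset.sum_congr rfl fun b hb => h2 b (Finset.mem_filter.1 hb).2, Finset.sum_filter,
        Finset.sum_congr rfl (g := fun b => ∑ c ∈ colourings Θ p, (y c b - x b) * J c b)
          fun b _ => by
            split_ifs with hb
            · exact (h3 b hb).symm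
            · rfl, Finset.sum_comm]
      exact Finset.sum_congr rfl fun c _ => sum_integral_eval_pderiv_segPoint x (y c) F
    rw [treeSum_succ, Finset.sum_congr rfl fun b hb => hint b (Finset.mem_filter.1 hb).2,
      Finset.sum_comm]
    simp only [← Finset.mul_sum, hcol, Finset.sum_sub_distrib, mul_sub, Finset.sum_const,
      nsmul_eq_mul]
    -- What remains is the value at `[Θ]` times the weighted count of colourings, zero because there
    -- is more than one block.
    rw [colourSum, sub_eq_self]
    simp only [← mul_assoc]
    rw [← Finset.sum_mul, sum_log_card_colourings hΘ, if_neg (Nat.succ_ne_zero m), zero_mul]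

end Interpolation

/-! ### Joint cumulants as sums over surjective colourings -/

section Cumulant

variable {S : Type*} [Fintype S]

open scoped Classical in
/-- The indicator of a colour class as an exponent vector. -/
def classExponent {p : ℕ} (c : S → Fin p) (j : Fin p) : S →₀ ℕ :=
  Finsupp.equivFunOnFinite.symm fun s => if c s = j then 1 else 0

open scoped Classical in
theorem classExponent_apply {p : ℕ} (c : S → Fin p) (j : Fin p) (s : S) :
    classExponent c j s = if c s = j then 1 else 0 := rfl

open scoped Classical in
/-- The squarefree coefficient of a power, as a sum over colourings of the variables. -/
theorem coeff_pow_squarefree (U : MvPowerSeries S ℝ) (p : ℕ) :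
    MvPowerSeries.coeff (Finsupp.equivFunOnFinite.symm fun _ : S => 1) (U ^ p) =
      ∑ c : S → Fin p, ∏ j, MvPowerSeries.coeff (classExponent c j) U := by
  have hU : U ^ p = ∏ _j : Fin p, U := by simp
  rw [hU, MvPowerSeries.coeff_prod]
  symm
  refine Finset.sum_bij (fun c _ => Finsupp.equivFunOnFinite.symm (classExponent c)) ?_ ?_ ?_ ?_
  · intro c _
    rw [Finset.mem_finsuppAntidiag]
    refine ⟨?_, Finset.subset_univ _⟩
    ext s
    rw [Finsupp.finsetSum_apply]
    simp [classExponent_apply]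
  · intro c _ d _ h
    ext s
    have h1 := DFunLike.congr_fun (DFunLike.congr_fun h (c s)) s
    simp only [Finsupp.equivFunOnFinite_symm_apply_apply, classExponent_apply, if_true] at h1
    by_contra hne
    rw [if_neg] at h1
    · exact one_ne_zero h1
    · exact fun h2 => hne (congrArg Fin.val h2.symm)
  · intro l hl
    -- Every variable has total exponent one, so exactly one factor carries it; that factor is its
    -- colour.
    have hsum : ∀ s, ∑ j, l j s = 1 := by
      intro s
      have := DFunLike.congr_fun (Finset.mem_finsuppAntidiag.1 hl).1 s
      rwa [Finsupp.finsetSum_apply] at this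
    have hex : ∀ s, ∃ j, l j s ≠ 0 := by
      intro s
      by_contra hcon
      push Not at hcon
      have := hsum s
      simp [hcon] at this
    choose c hc using hex
    refine ⟨c, Finset.mem_univ _, ?_⟩
    ext j s
    simp only [Finsupp.equivFunOnFinite_symm_apply_apply, classExponent_apply]
    have h1 := hsum s
    rw [← Finset.add_sum_erase _ _ (Finset.mem_univ (c s))] at h1
    have h2 := hc s
    have h3 : ∑ j ∈ Finset.univ.erase (c s), l j s = 0 := by omega
    split_ifs with hj
    · subst hj
      omega
    · exact (Finset.sum_eq_zero_iff.1 h3 j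
        (Finset.mem_erase.2 ⟨fun h => hj h.symm, Finset.mem_univ _⟩)).symm
  · intro c _
    rfl

variable {Ω : Type*} [MeasurableSpace Ω]

-- Removing the constant term 1 makes an empty colour class contribute zero, so only surjective
-- colourings survive and the logarithm series stops at the number of variables.
open scoped Classical in
theorem jointCumulant_eq_sum (P : Measure Ω) [IsProbabilityMeasure P] (X : S → Ω → ℝ) {K : ℕ}
    (hK : Fintype.card S ≤ K) :
    jointCumulant P X = ∑ p ∈ Finset.range (K + 1), PowerSeries.coeff p (PowerSeries.log ℝ) *
      ∑ c ∈ Finset.univ.filter (fun c : S → Fin p => Function.Surjective c),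
        ∏ j, ∫ ω, ∏ s ∈ Finset.univ.filter (fun s => c s = j), X s ω ∂P := by
  set U := formalMGF P X - 1 with hU
  have h0 : MvPowerSeries.coeff 0 U = 0 := by
    have : MvPowerSeries.coeff 0 (formalMGF P X) = 1 := by
      change (∫ ω, ∏ i, X i ω ^ ((0 : S →₀ ℕ) i) ∂P) /
        ∏ i, ((((0 : S →₀ ℕ) i).factorial : ℕ) : ℝ) = 1
      simp
    rw [hU, map_sub, this, MvPowerSeries.coeff_zero_one, sub_self]
  have hclass : ∀ {p : ℕ} (c : S → Fin p), Function.Surjective c → ∀ j,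
      MvPowerSeries.coeff (classExponent c j) U =
        ∫ ω, ∏ s ∈ Finset.univ.filter (fun s => c s = j), X s ω ∂P := by
    intro p c hc j
    have hne : classExponent c j ≠ 0 := by
      obtain ⟨s, hs⟩ := hc j
      intro h
      have := DFunLike.congr_fun h s
      simp [classExponent_apply, hs] at this
    have hf : MvPowerSeries.coeff (classExponent c j) (formalMGF P X) =
        ∫ ω, ∏ s ∈ Finset.univ.filter (fun s => c s = j), X s ω ∂P := by
      change (∫ ω, ∏ i, X i ω ^ (classExponent c j i) ∂P) /
        ∏ i, (((classExponent c j i).factorial : ℕ) : ℝ) = _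
      have h1 : ∏ i, (((classExponent c j i).factorial : ℕ) : ℝ) = 1 := by
        refine Finset.prod_eq_one fun i _ => ?_
        rw [classExponent_apply]
        split_ifs <;> simp
      rw [h1, div_one]
      refine integral_congr_ae (Filter.Eventually.of_forall fun ω => ?_)
      simp only [classExponent_apply, Finset.prod_filter]
      refine Finset.prod_congr rfl fun i _ => ?_
      split_ifs <;> simp
    rw [hU, map_sub, hf, MvPowerSeries.coeff_one, if_neg hne, sub_zero]
  have hpow : ∀ p : ℕ, MvPowerSeries.coeff (Finsupp.equivFunOnFinite.symm fun _ : S => 1) (U ^ p) =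
      ∑ c ∈ Finset.univ.filter (fun c : S → Fin p => Function.Surjective c),
        ∏ j, ∫ ω, ∏ s ∈ Finset.univ.filter (fun s => c s = j), X s ω ∂P := by
    intro p
    rw [coeff_pow_squarefree, Finset.sum_filter]
    refine Finset.sum_congr rfl fun c _ => ?_
    split_ifs with hc
    · exact Finset.prod_congr rfl fun j _ => hclass c hc j
    · obtain ⟨j, hj⟩ := not_forall.1 hc
      refine Finset.prod_eq_zero (Finset.mem_univ j) ?_
      have : classExponent c j = 0 := by
        ext s
        rw [classExponent_apply, if_neg fun h => hj ⟨s, h⟩]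
        rfl
      rw [this, h0]
  have hsub : PowerSeries.HasSubst U := PowerSeries.HasSubst.of_constantCoeff_zero h0
  rw [jointCumulant, ← hU, PowerSeries.coeff_subst hsub]
  simp only [hpow, smul_eq_mul]
  refine finsum_eq_sum_of_support_subset _ fun p hp => ?_
  rw [Finset.coe_range, Set.mem_Iio]
  by_contra hlt
  refine hp ?_
  have hempty : Finset.univ.filter (fun c : S → Fin p => Function.Surjective c) = ∅ := by
    refine Finset.filter_eq_empty_iff.2 fun c _ hc => ?_
    have := Fintype.card_le_of_surjective c hc
    rw [Fintype.card_fin] at this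
    omega
  simp only [hempty, Finset.sum_empty, mul_zero]

end Cumulant

/-! ### Expectations of polynomials in recoupled families -/

section Recoupling

open MvPolynomial

variable {n N : ℕ}

theorem wick_prod_of_uncorrelated {V R ι : Type*} [Fintype V] [CommRing R] [Algebra ℝ R]
    {c : V → V → R} (hc : ∀ p q, c p q = c q p) {A : ι → Set V}
    (hA : ∀ i j, i ≠ j → ∀ p ∈ A i, ∀ q ∈ A j, c p q = 0) {g : ι → MvPolynomial V ℝ}
    (hg : ∀ i, g i ∈ supported ℝ (A i)) (s : Finset ι) :
    wick c (∏ i ∈ s, g i) = ∏ i ∈ s, wick c (g i) := by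
  classical
  induction s using Finset.induction_on with
  | empty => simp
  | insert i s hi ih =>
    rw [Finset.prod_insert hi, Finset.prod_insert hi, ← ih]
    refine wick_mul_of_uncorrelated hc (A := A i) (B := ⋃ j ∈ s, A j) ?_ (hg i) ?_
    · intro p hp q hq
      simp only [Set.mem_iUnion] at hq
      obtain ⟨j, hj, hq⟩ := hq
      exact hA i j (fun h => hi (h ▸ hj)) p hp q hq
    · refine prod_mem fun j hj => ?_
      exact supported_mono (Set.subset_biUnion_of_mem (u := A) hj) (hg j)

variable {Ω : Type*} [MeasurableSpace Ω]

/-- The covariances of the recoupled family, as polynomials in the entries of the coupling. -/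
def recoupledCov (P : Measure Ω) (ζ : Var n N → Ω → ℝ) (p q : Var n N) :
    MvPolynomial (Sym2 (Fin n)) ℝ :=
  C (∫ ω, ζ p ω * ζ q ω ∂P) * X s(p.1, q.1)

variable (P : Measure Ω) (ζ : Var n N → Ω → ℝ)

theorem recoupledCov_symm (p q : Var n N) : recoupledCov P ζ p q = recoupledCov P ζ q p := by
  simp only [recoupledCov, mul_comm (ζ p _), Sym2.eq_swap (a := p.1)]

/-- The expectation of `g` under the recoupled family, as a polynomial in the entries of the
coupling. -/
def recoupledMean (g : MvPolynomial (Var n N) ℝ) : MvPolynomial (Sym2 (Fin n)) ℝ :=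
  wick (recoupledCov P ζ) g

theorem eval_recoupledMean (x : Sym2 (Fin n) → ℝ) (g : MvPolynomial (Var n N) ℝ) :
    eval x (recoupledMean P ζ g) =
      wick (fun p q => x s(p.1, q.1) * ∫ ω, ζ p ω * ζ q ω ∂P) g := by
  have := wick_comp_algHom (MvPolynomial.aeval x : MvPolynomial (Sym2 (Fin n)) ℝ →ₐ[ℝ] ℝ)
    (recoupledCov_symm P ζ) g
  rw [recoupledMean, ← coe_aeval_eq_eval]
  refine this.trans ?_
  congr 1
  congr 1
  ext p q
  simp [recoupledCov, mul_comm]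

variable {P ζ}

theorem integral_recoupling {Ω' : Type*} [MeasurableSpace Ω'] {P' : Measure Ω'}
    {ζ' : Var n N → Ω' → ℝ} {Q : Matrix (Fin n) (Fin n) ℝ} (hQ : Q ∈ couplings n)
    (h : IsRecoupling P ζ Q P' ζ') (g : MvPolynomial (Var n N) ℝ) :
    ∫ ω, polyVar g ζ' ω ∂P' = eval (entries Q) (recoupledMean P ζ g) := by
  rw [eval_recoupledMean]
  refine (h.centred.integral_eval g).trans ?_
  congr 1
  congr 1
  ext p q
  rw [h.covariance, entries_of_mem_couplings hQ]

/-! ### Bond operators and derivatives in the coupling entries -/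

theorem bondOp_mk (i i' : Fin n) (g : MvPolynomial (Var n N) ℝ) :
    bondOp N s(i, i') g = ∑ j, pderiv (i, j) (pderiv (i', j) g) := by
  simp only [bondOp, Sym2.lift_mk, LinearMap.sum_apply]
  rfl

theorem bondOp_pderiv (b : Sym2 (Fin n)) (q : Var n N) (g : MvPolynomial (Var n N) ℝ) :
    bondOp N b (pderiv q g) = pderiv q (bondOp N b g) := by
  induction b using Sym2.ind with
  | _ i i' =>
    have hcomm : Commute (bondOp N s(i, i')) (partialOp q) := by
      simp only [bondOp, Sym2.lift_mk]
      exact Commute.sum_left _ _ _ fun j _ =>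
        (partialOp_commute _ _).mul_left (partialOp_commute _ _)
    exact LinearMap.congr_fun hcomm g

/-- The commutator of a second-order operator with multiplication by a variable has first order. The
two corrections are added, not separated into cases, since both occur when `i = i'`. -/
theorem bondOp_X_mul (i i' : Fin n) (p : Var n N) (g : MvPolynomial (Var n N) ℝ) :
    bondOp N s(i, i') (X p * g) = X p * bondOp N s(i, i') g +
      ((if p.1 = i' then pderiv (i, p.2) g else 0) +
        if p.1 = i then pderiv (i', p.2) g else 0) := by
  have h : ∀ j, pderiv (i, j) (pderiv (i', j) (X p * g)) = X p * pderiv (i, j) (pderiv (i', j) g) +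
      ((if j = p.2 then if p.1 = i' then pderiv (i, p.2) g else 0 else 0) +
        if j = p.2 then if p.1 = i then pderiv (i', p.2) g else 0 else 0) := by
    intro j
    have hX : ∀ (k : Fin n) (r : MvPolynomial (Var n N) ℝ), pderiv (k, j) (X p) * r =
        if j = p.2 then if p.1 = k then r else 0 else 0 := by
      intro k r
      obtain ⟨a, b⟩ := p
      rw [pderiv_X, Pi.single_apply]
      simp only [Prod.mk.injEq]
      by_cases h1 : j = b
      · by_cases h2 : a = k <;> simp [h1, h2]
      · simp [h1, Ne.symm h1]
    rw [pderiv_mul, hX, map_add, pderiv_mul, hX]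
    split_ifs with h1
    · subst h1
      ring
    · subst h1
      simp
      ring
    · subst h1
      simp
      ring
    · subst h1
      simp
    · simp
  rw [bondOp_mk, bondOp_mk, Finset.sum_congr rfl fun j _ => h j, Finset.sum_add_distrib,
    Finset.sum_add_distrib, Finset.mul_sum, Finset.sum_ite_eq', Finset.sum_ite_eq']
  simp

/-- Differentiating the expectation with respect to an off-diagonal entry of the coupling. -/
theorem pderiv_recoupledMean
    (hcov : ∀ i i' j j', ∫ ω, ζ (i, j) ω * ζ (i', j') ω ∂P =
      if j = j' then ∫ ω, ζ (i, 0) ω * ζ (i', 0) ω ∂P else 0)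
    {b : Sym2 (Fin n)} (hb : ¬ b.IsDiag) (g : MvPolynomial (Var n N) ℝ) :
    pderiv b (recoupledMean P ζ g) = bondCov P ζ b • recoupledMean P ζ (bondOp N b g) := by
  -- The defect of the claimed identity kills 1 and satisfies the Wick recursion, hence vanishes.
  let T : MvPolynomial (Var n N) ℝ →ₗ[ℝ] MvPolynomial (Sym2 (Fin n)) ℝ :=
    (pderiv b : Derivation ℝ (MvPolynomial (Sym2 (Fin n)) ℝ) _).toLinearMap ∘ₗ
      wick (recoupledCov P ζ) - bondCov P ζ b • (wick (recoupledCov P ζ) ∘ₗ bondOp N b)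
  have hTg : ∀ g, T g = pderiv b (wick (recoupledCov P ζ) g) -
      bondCov P ζ b • wick (recoupledCov P ζ) (bondOp N b g) := fun g => rfl
  suffices h : T g = 0 by
    rw [hTg, sub_eq_zero] at h
    exact h
  refine eq_zero_of_wick_recursion (A := Set.univ) (recoupledCov P ζ) T ?_ (fun p _ g _ => ?_)
    (by simp)
  · rw [hTg, wick_one]
    induction b using Sym2.ind with
    | _ i i' =>
      rw [bondOp_mk]
      simp
  · have hW := recoupledCov_symm P ζ
    -- Differentiating the covariances in the recursion yields precisely the commutator of `bondOp N
    -- b` with `X p`. By `hcov` only the `q` with the same second index as `p` contributes. On the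
    -- diagonal the commutator would be twice too large.
    have hd : ∑ q, pderiv b (recoupledCov P ζ p q) * wick (recoupledCov P ζ) (pderiv q g) =
        bondCov P ζ b • (wick (recoupledCov P ζ) (bondOp N b (X p * g)) -
          ∑ q, recoupledCov P ζ p q * wick (recoupledCov P ζ) (bondOp N b (pderiv q g))) := by
      induction b using Sym2.ind with
      | _ i i' =>
        have hne : i ≠ i' := fun h => hb (by rw [Sym2.mk_isDiag_iff]; exact h)
        have hterm : ∀ q, pderiv s(i, i') (recoupledCov P ζ p q) =
            C (∫ ω, ζ p ω * ζ q ω ∂P) *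
              if (p.1 = i ∧ q.1 = i') ∨ (p.1 = i' ∧ q.1 = i) then 1 else 0 := by
          intro q
          rw [recoupledCov, pderiv_C_mul, pderiv_X, Pi.single_apply]
          simp only [Sym2.eq_iff]
        simp only [hterm, bondOp_X_mul, map_add, wick_X_mul hW, bondOp_pderiv, add_sub_cancel_left]
        obtain ⟨a, j⟩ := p
        have hbc : bondCov P ζ s(i, i') = ∫ ω, ζ (i, 0) ω * ζ (i', 0) ω ∂P := rfl
        by_cases h1 : a = i
        · subst h1
          simp only [if_true, true_and, hne, false_and, or_false]
          rw [Finset.sum_eq_single (i', j)]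
          · rw [hcov, if_pos rfl, hbc, smul_eq_C_mul]
            simp
          · rintro ⟨k, l⟩ _ hkl
            by_cases hk : k = i'
            · have hl : j ≠ l := fun h => hkl (by rw [hk, h])
              rw [hcov, if_neg hl]
              simp
            · simp [hk]
          · simp
        by_cases h2 : a = i'
        · subst h2
          simp only [h1, if_true, true_and, false_and, false_or, if_false, map_zero, add_zero]
          rw [Finset.sum_eq_single (i, j)]
          · rw [hcov, if_pos rfl, hbc, smul_eq_C_mul]
            simp [mul_comm (ζ (a, 0) _)]
          · rintro ⟨k, l⟩ _ hkl
            by_cases hk : k = i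
            · have hl : j ≠ l := fun h => hkl (by rw [hk, h])
              rw [hcov, if_neg hl]
              simp
            · simp [hk]
          · simp
        · simp [h1, h2]
    simp only [hTg, mul_sub, Finset.sum_sub_distrib]
    have h1 : pderiv b (wick (recoupledCov P ζ) (X p * g)) =
        ∑ q, pderiv b (recoupledCov P ζ p q) * wick (recoupledCov P ζ) (pderiv q g) +
        ∑ q, recoupledCov P ζ p q * pderiv b (wick (recoupledCov P ζ) (pderiv q g)) := by
      rw [wick_X_mul hW, map_sum, ← Finset.sum_add_distrib]
      exact Finset.sum_congr rfl fun q _ => pderiv_mul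
    rw [h1, hd, smul_sub, Finset.smul_sum]
    simp only [mul_smul_comm]
    abel

theorem treeOp_empty : treeOp N (∅ : Finset (Sym2 (Fin n))) = 1 :=
  Finset.noncommProd_empty _ _

theorem treeOp_insert {b : Sym2 (Fin n)} {Γ : Finset (Sym2 (Fin n))} (hb : b ∉ Γ) :
    treeOp N (insert b Γ) = treeOp N Γ * bondOp N b :=
  Finset.noncommProd_insert_of_notMem' Γ b (bondOp N) (fun e _ e' _ _ => bondOp_commute e e') hb

/-- Injectivity lets the product along the sequence be rewritten as a product over the set of its
bonds. -/
theorem iterDeriv_recoupledMean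
    (hcov : ∀ i i' j j', ∫ ω, ζ (i, j) ω * ζ (i', j') ω ∂P =
      if j = j' then ∫ ω, ζ (i, 0) ω * ζ (i', 0) ω ∂P else 0)
    {m : ℕ} {e : Fin m → Sym2 (Fin n)} (he : Function.Injective e) (hd : ∀ α, ¬ (e α).IsDiag)
    (g : MvPolynomial (Var n N) ℝ) :
    iterDeriv m e (recoupledMean P ζ g) = (∏ b ∈ Finset.univ.image e, bondCov P ζ b) •
      recoupledMean P ζ (treeOp N (Finset.univ.image e) g) := by
  induction m generalizing g with
  | zero =>
    rw [Finset.univ_eq_empty, Finset.image_empty, Finset.prod_empty, one_smul,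
      treeOp_empty]
    rfl
  | succ m ih =>
    have hnot : e 0 ∉ Finset.univ.image (Fin.tail e) := by
      intro h
      obtain ⟨α, -, hα⟩ := Finset.mem_image.1 h
      exact Fin.succ_ne_zero α (he hα)
    have hit : Function.Injective (Fin.tail e) := he.comp (Fin.succ_injective m)
    rw [iterDeriv, pderiv_recoupledMean hcov (hd 0), iterDeriv_smul,
      ih hit (fun α => hd α.succ), image_univ_succ, treeOp_insert hnot,
      Finset.prod_insert hnot, smul_smul]
    rfl

/-- At the partition into colour classes the expectation of a product factorizes. -/
theorem colourValue_recoupledMean [IsProbabilityMeasure P] (hζ : IsCentredGaussian P ζ)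
    {Θ : SetPart n} {f : {A // A ∈ Θ.parts} → MvPolynomial (Var n N) ℝ}
    (hf : ∀ A, f A ∈ MvPolynomial.supported ℝ {p : Var n N | p.1 ∈ A.1}) {k : ℕ}
    (d : {A // A ∈ Θ.parts} → Fin k) :
    colourValue (recoupledMean P ζ (∏ A, f A)) (d ∘ blockOf Θ) =
      ∏ j, ∫ ω, ∏ A ∈ Finset.univ.filter (fun A => d A = j), polyVar (f A) ζ ω ∂P := by
  classical
  set x := entries (partMatrix (colourPart (d ∘ blockOf Θ))) with hx
  have hxe : ∀ a b, x s(a, b) = if d (blockOf Θ a) = d (blockOf Θ b) then 1 else 0 := by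
    intro a b
    rw [hx, entries_partMatrix]
    simp only [inBlock_mk, sameBlock_colourPart, Function.comp_apply]
  let c : Var n N → Var n N → ℝ := fun p q => ∫ ω, ζ p ω * ζ q ω ∂P
  let c' : Var n N → Var n N → ℝ := fun p q => x s(p.1, q.1) * c p q
  have hc : ∀ p q, c p q = c q p := fun p q => by simp only [c, mul_comm]
  have hc' : ∀ p q, c' p q = c' q p := fun p q => by
    simp only [c', hc p q, Sym2.eq_swap (a := p.1)]
  let V : Fin k → Set (Var n N) := fun j => {p | d (blockOf Θ p.1) = j}
  let g : Fin k → MvPolynomial (Var n N) ℝ := fun j =>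
    ∏ A ∈ Finset.univ.filter (fun A => d A = j), f A
  have hg : ∀ j, g j ∈ supported ℝ (V j) := by
    intro j
    refine prod_mem fun A hA => ?_
    refine supported_mono (fun p hp => ?_) (hf A)
    have : blockOf Θ p.1 = A := blockOf_eq_iff.2 hp
    change d (blockOf Θ p.1) = j
    rw [this]
    exact (Finset.mem_filter.1 hA).2
  have hprod : ∏ A, f A = ∏ j, g j :=
    (Finset.prod_fiberwise_of_maps_to (fun A _ => Finset.mem_univ (d A)) f).symm
  rw [colourValue, eval_recoupledMean, hprod]
  change wick c' _ = _
  rw [wick_prod_of_uncorrelated hc' (A := V) ?_ hg]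
  · refine Finset.prod_congr rfl fun j _ => ?_
    -- Within a colour class the coupling entries are 1, so the original covariances return.
    have h1 : wick c' (g j) = wick c (g j) := by
      refine wick_eq_of_eqOn hc' hc (A := V j) (fun p hp q hq => ?_) (hg j)
      have hpq : d (blockOf Θ p.1) = d (blockOf Θ q.1) := Eq.trans hp (Eq.symm hq)
      simp only [c', hxe, if_pos hpq, one_mul]
    rw [h1, ← hζ.integral_eval]
    simp only [g, map_prod]
    rfl
  · intro i j hij p hp q hq
    have hpq : ¬ d (blockOf Θ p.1) = d (blockOf Θ q.1) := fun h =>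
      hij ((Eq.symm hp).trans (h.trans hq))
    simp only [c', hxe, if_neg hpq, zero_mul]

theorem jointCumulant_eq_treeSum [IsProbabilityMeasure P] (hζ : IsCentredGaussian P ζ)
    {Θ : SetPart n} {f : {A // A ∈ Θ.parts} → MvPolynomial (Var n N) ℝ}
    (hf : ∀ A, f A ∈ MvPolynomial.supported ℝ {p : Var n N | p.1 ∈ A.1}) {m : ℕ}
    (hΘ : Θ.parts.card = m + 1) :
    jointCumulant P (fun A => polyVar (f A) ζ) = treeSum m Θ (recoupledMean P ζ (∏ A, f A)) := by
  classical
  have hcard : Fintype.card {A // A ∈ Θ.parts} ≤ n := by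
    rw [Fintype.card_coe]
    simpa using Θ.card_parts_le_card
  rw [treeSum_eq_colourSum hΘ, jointCumulant_eq_sum P _ hcard, colourSum]
  refine Finset.sum_congr rfl fun p _ => ?_
  rw [sum_colourings]
  congr 1
  exact Finset.sum_congr (by ext; simp) fun d _ => (colourValue_recoupledMean hζ hf d).symm

/-- Merging sequences are grouped by their set of bonds; each group consists of all enumerations of
one tree, which is how its measure is defined. -/
theorem treeSum_recoupledMean
    (hcov : ∀ i i' j j', ∫ ω, ζ (i, j) ω * ζ (i', j') ω ∂P =
      if j = j' then ∫ ω, ζ (i, 0) ω * ζ (i', 0) ω ∂P else 0)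
    {Θ : SetPart n} (hΘ : Θ.parts.card = Θ.parts.card - 1 + 1) (g : MvPolynomial (Var n N) ℝ) :
    treeSum (Θ.parts.card - 1) Θ (recoupledMean P ζ g) =
      ∑ Γ ∈ trees Θ, (∏ b ∈ Γ, bondCov P ζ b) *
        ∫ Q, eval (entries Q) (recoupledMean P ζ (treeOp N Γ g)) ∂treeMeasure Θ Γ := by
  classical
  rw [treeSum, ← Finset.sum_fiberwise_of_maps_to
    (g := fun e => Finset.univ.image e) (t := trees Θ)
    fun e he => (joinsUp_iff_mem_trees hΘ e).1 (Finset.mem_filter.1 he).2]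
  refine Finset.sum_congr rfl fun Γ hΓ => ?_
  rw [(integral_treeMeasure Θ Γ (continuous_eval_comp continuous_entries _)).2, Finset.mul_sum]
  refine Finset.sum_congr ?_ fun e he => ?_
  · ext e
    simp only [Finset.mem_filter, Finset.mem_univ, true_and, and_iff_right_iff_imp]
    rintro rfl
    exact (joinsUp_iff_mem_trees hΘ e).2 hΓ
  · have hΓe := (Finset.mem_filter.1 he).2
    have hup : JoinsUp _ Θ e := (joinsUp_iff_mem_trees hΘ e).2 (hΓe ▸ hΓ)
    rw [iterDeriv_recoupledMean hcov hup.injective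
      fun α hα => hup.not_inBlock α (inBlock_of_isDiag Θ hα), hΓe, ← integral_const_mul]
    simp only [smul_eval]

end Recoupling

end BKAR

end

/-! ### Assembly of the theorem -/

theorem theorem3 {n N : ℕ} (hn : 0 < n) (hN : 0 < N) (Θ : SetPart n)
    (f : {A // A ∈ Θ.parts} → MvPolynomial (Var n N) ℝ)
    (hf : ∀ A, f A ∈ MvPolynomial.supported ℝ {p : Var n N | p.1 ∈ A.1})
    {Ω : Type*} [MeasurableSpace Ω] (P : Measure Ω) [IsProbabilityMeasure P]
    (ζ : Var n N → Ω → ℝ) (hζ : IsCentredGaussian P ζ)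
    (hcov : ∀ i i' j j', ∫ ω, ζ (i, j) ω * ζ (i', j') ω ∂P =
      if j = j' then ∫ ω, ζ (i, 0) ω * ζ (i', 0) ω ∂P else 0) :
    -- the cumulant is that of variables with absolute moments of all orders
    (∀ A (m : ℕ), Integrable (fun ω => |polyVar (f A) ζ ω| ^ m) P) ∧
    -- the recoupled family exists and has a uniquely determined law
    (∀ Q ∈ couplings n, ∃! ν : Measure (Var n N → ℝ), IsRecoupling P ζ Q ν fun p x => x p) ∧
    -- the tree measures are probability measures on the set of couplings
    (∀ Γ ∈ trees Θ, IsProbabilityMeasure (treeMeasure Θ Γ) ∧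
      ∀ᵐ Q ∂treeMeasure Θ Γ, Q ∈ couplings n) ∧
    -- for any choice of recoupled families the iterated integrals exist and the formula holds
    ∀ (Ω' : Matrix (Fin n) (Fin n) ℝ → Type*) [∀ Q, MeasurableSpace (Ω' Q)]
      (P' : ∀ Q, Measure (Ω' Q)) (ζ' : ∀ Q, Var n N → Ω' Q → ℝ),
      (∀ Q ∈ couplings n, IsRecoupling P ζ Q (P' Q) (ζ' Q)) →
      (∀ g : MvPolynomial (Var n N) ℝ,
        (∀ Q ∈ couplings n, Integrable (polyVar g (ζ' Q)) (P' Q)) ∧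
        ∀ Γ ∈ trees Θ,
          Integrable (fun Q => ∫ ω, polyVar g (ζ' Q) ω ∂P' Q) (treeMeasure Θ Γ)) ∧
      jointCumulant P (fun A => polyVar (f A) ζ) =
        ∑ Γ ∈ trees Θ, (∏ e ∈ Γ, bondCov P ζ e) *
          ∫ Q, (∫ ω, polyVar (treeOp N Γ (∏ A, f A)) (ζ' Q) ω ∂P' Q) ∂treeMeasure Θ Γ := by
  have hcard : Θ.parts.card = Θ.parts.card - 1 + 1 := by
    have : 0 < Θ.parts.card := Finset.card_pos.2
      (Θ.parts_nonempty (Finset.univ_nonempty_iff.2 ⟨⟨0, hn⟩⟩).ne_empty)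
    omega
  refine ⟨fun A m => ?_, fun Q hQ => existsUnique_recoupling hζ hQ,
    fun Γ hΓ => ⟨isProbabilityMeasure_treeMeasure hΓ, ae_mem_couplings Θ Γ⟩,
    fun Ω' _ P' ζ' hζ' => ?_⟩
  · have h := (hζ.integrable_eval (f A ^ m)).abs
    refine h.congr (Filter.Eventually.of_forall fun ω => ?_)
    simp only [map_pow, abs_pow]
    rfl
  -- Equality holds only almost everywhere: away from the couplings the chosen families are
  -- arbitrary. It also supplies the measurability in `Q`.
  have hae : ∀ (g : MvPolynomial (Var n N) ℝ) (Γ : Finset (Sym2 (Fin n))),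
      (fun Q => MvPolynomial.eval (entries Q) (recoupledMean P ζ g)) =ᵐ[treeMeasure Θ Γ]
        fun Q => ∫ ω, polyVar g (ζ' Q) ω ∂P' Q := by
    intro g Γ
    filter_upwards [ae_mem_couplings Θ Γ] with Q hQ
    exact (integral_recoupling hQ (hζ' Q hQ) g).symm
  refine ⟨fun g => ⟨fun Q hQ => (hζ' Q hQ).centred.integrable_eval g, fun Γ _ => ?_⟩, ?_⟩
  · exact (integral_treeMeasure Θ Γ (continuous_eval_comp continuous_entries _)).1.congr (hae g Γ)
  · rw [jointCumulant_eq_treeSum hζ hf hcard, treeSum_recoupledMean hcov hcard]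
    exact Finset.sum_congr rfl fun Γ _ => by rw [integral_congr_ae (hae _ Γ)]
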